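/- **Setting.** Let $\mathcal F=\bigcup_n\mathcal F_n$ be a set of function symbols whose arities are bounded, $K$ the largest arity, $\mathcal X$ a set of variables, and $\mathcal T$ the set of terms. The depth $\delta(t)$ is the number of levels of $t$: $\delta(t)=1$ for variables and constants and $\delta(f(t_1,\dots,t_n))=1+\max_i\delta(t_i)$. The arity $ar(t)$ of $t$ is that of its root symbol ($0$ for a variable). A *context* $\tau$ is a term with exactly one occurrence of a hole $\square$; $\tau\cdot\tau'=\tau[\tau']$ is $\tau$ with its hole replaced by $\tau'$. A term $u$ *matches* $t$ if $\sigma(u)=t$ for some substitution $\sigma$. **Position-based CE-strategies.** These are lists $[@p_1.\tau_1,\dots,@p_n.\tau_n]$ ($n\ge 0$) with pairwise distinct positions $p_i$ (words over $\mathbb N$), in which no $p_i$ is a strict prefix of a later $p_j$, and contexts $\tau_i$; the empty list $\emptyset$ is the failing strategy. Two lists are considered equal if they differ by a permutation. $E\sqcap E'$ is $\emptyset$ if $E=\emptyset$ or $E'=\emptyset$; otherwise it consists of all $@p.(\tau\cdot\tau')$ with $@p.\tau$ in $E$ and $@p.\tau'$ in $E'$, and of all insertions of $E$ or $E'$ at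 a position that does not occur in the other one. **CE-strategies.** They are given by the grammar $$S,S' ::= \emptyset \mid X \mid u;S \mid S\oplus S' \mid \mu X.S \mid \mathrm{Most}(S)\mid \mathrm{If}\ S\ \mathrm{Then}\ S' \mid \textstyle\bigwedge_{i\in I}@i.S_i\,[\wedge\,@\varepsilon.\tau],$$ with fixed-point variables $X$, terms $u$, finite $I\subset\mathbb N$, and a context $\tau$; the component $@\varepsilon.\tau$ is optional (for $I=\emptyset$ the last form is $@\varepsilon.\tau$). A CE-strategy is *closed* if all fixed-point variables are bound, and *monotonic* if in each of its fixed points $\mu X.S$ every free occurrence of $X$ in $S$ lies below some $@i$ with $i\in\mathbb N$ or some $\mathrm{Most}$. $S(R)$ denotes $S$ with $X$ replaced by $R$; $\mu^0X.S=\emptyset$ and $\mu^{n+1}X.S=S(\mu^nX.S)$. **The map $\Psi$.** For a closed CE-strategy $S$ and a term $t$, the position-based CE-strategy $\Psi_t(S)$ is given by: $\Psi_t(\emptyset)=\emptyset$; $\Psi_t(u;S)=\Psi_t(S)$ if $u$ matches $t$, else $\emptyset$; $\Psi_t(S\oplus S')=\Psi_t(S)$ if this is not $\emptyset$, else $\Psi_t(S')$;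 $\Psi_t(\mathrm{If}\ S'\ \mathrm{Then}\ S)=\Psi_t(S)$ if $\Psi_t(S')\ne\emptyset$, else $\emptyset$; $\Psi_t(\mu X.S)=\Psi_t(\mu^{\delta(t)}X.S)$; $\Psi_t(\mathrm{Most}(S))=\Psi_t(\bigwedge_{i=1}^{ar(t)}@i.S)$; and $\Psi_t(\bigwedge_{i\in I}@i.S_i\,[\wedge\,@\varepsilon.\tau])$ consists of all $@(ip).\sigma$ with $i\in I$ a position of $t$ and $@p.\sigma$ in $\Psi_{t_{|i}}(S_i)$, and of $@\varepsilon.\tau$ if that component is present. **The system Unif.** Pre-CE-strategies are built by the same grammar from CE-strategies and tuples $\langle S,S',M\rangle$, where $S,S'$ are CE-strategies and the memory $M$ is a set of triples (CE-strategy, CE-strategy, fixed-point variable); the condition of an "If" is always a CE-strategy. A step of Unif rewrites a tuple, anywhere in a pre-CE-strategy, by the first applicable rule of the following list: 1. $\langle\emptyset,S,M\rangle\to\emptyset$; then $\langle S,\emptyset,M\rangle\to\emptyset$. 2. $\langle@\varepsilon.\tau,@\varepsilon.\tau',M\rangle\to@\varepsilon.(\tau\cdot\tau')$. 3. $\langle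 u;S,S',M\rangle\to u;\langle S,S',M\rangle$; then $\langle S',u;S,M\rangle\to u;\langle S',S,M\rangle$. 4. $\langle@i.S,@i.S',M\rangle\to@i.\langle S,S',M\rangle$; then, for $S=\bigwedge_{i\in I}@i.S_i\,[\wedge@\varepsilon.\tau]$ and $S'=\bigwedge_{j\in J}@j.S'_j\,[\wedge@\varepsilon.\tau']$, $\langle S,S',M\rangle\to \mathrm{If}\ S\ \mathrm{Then}\ \mathrm{If}\ S'\ \mathrm{Then}\ \big(\bigwedge_{i\in I\cap J}@i.(\langle S_i,S'_i,M\rangle\oplus S_i\oplus S'_i)\wedge\bigwedge_{i\in I\setminus J}@i.S_i\wedge\bigwedge_{j\in J\setminus I}@j.S'_j\,[\wedge@\varepsilon.\tau'']\big)$, where $\tau''$ is $\tau\cdot\tau'$ if both are present, the one that is present if there is only one, and absent otherwise. 5. $\langle S_1\oplus S_2,S,M\rangle\to\langle S_1,S,M\rangle\oplus\langle S_2,S,M\rangle$; then $\langle S,S_1\oplus S_2,M\rangle\to\langle S,S_1,M\rangle\oplus\langle S,S_2,M\rangle$. 6. $\langle\mathrm{If}\ S_1\ \mathrm{Then}\ S_2,S,M\rangle\to\mathrm{If}\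 S_1\ \mathrm{Then}\ \langle S_2,S,M\rangle$; then $\langle S,\mathrm{If}\ S_1\ \mathrm{Then}\ S_2,M\rangle\to\mathrm{If}\ S_1\ \mathrm{Then}\ \langle S,S_2,M\rangle$. 7. $\langle\mathrm{Most}(S),\mathrm{Most}(S'),M\rangle\to\mathrm{If}\ \mathrm{Most}(S)\ \mathrm{Then}\ \mathrm{If}\ \mathrm{Most}(S')\ \mathrm{Then}\ \mathrm{Most}(\langle S,S',M\rangle\oplus S\oplus S')$; then $\langle\mathrm{Most}(S),L,M\rangle\to\langle\bigwedge_{i=1}^K@i.S,L,M\rangle$ and $\langle L,\mathrm{Most}(S),M\rangle\to\langle L,\bigwedge_{i=1}^K@i.S,M\rangle$ for $L=\bigwedge_{i\in I}@i.S_i\,[\wedge@\varepsilon.\tau]$. 8. For $\xi=\mu X.S$: $\langle\xi,S',M\rangle\to Z$ if $(\xi,S',Z)\in M$, and $\langle\xi,S',M\rangle\to\mu Z.\langle S(\xi),S',M\cup\{(\xi,S',Z)\}\rangle$ with a fresh variable $Z$ (not occurring in $\xi$, $S'$, $M$) if there is no such triple; then the mirror-image rule for $\langle S',\xi,M\rangle$.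 A normal form is a pre-CE-strategy to which no step applies. **Theorem.** Let $S$ and $R$ be closed monotonic CE-strategies. Then $\langle S,R,\emptyset\rangle$ has a normal form with respect to Unif, and every normal form of it is a closed CE-strategy. Writing $S\sqcap R$ for any such normal form (it depends on the choice of the fresh variables), we have for every term $t\in\mathcal T$ $$\Psi_t(S\sqcap R)=\Psi_t(S)\sqcap\Psi_t(R).$$ -/

import Mathlib

namespace CES

universe u v w

/-! ## Terms, one-hole contexts, matching

Function symbols are those of a first-order language `L` (`L.Functions n` is the set of symbols of
arity `n`; the relation symbols of `L` play no role), and terms over the variables `V` are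
`L.Term V`. -/

section Terms

variable {L : FirstOrder.Language.{u, v}} {V : Type w}

/-- The arity of the root symbol of a term (variables have arity `0`). -/
def arity : L.Term V → ℕ
  | .var _ => 0
  | .func (l := l) _ _ => l

/-- The depth of a term: the number of levels of its tree. Variables and constants have
depth `1`. -/
def depth : L.Term V → ℕ
  | .var _ => 1
  | .func _ ts => 1 + Finset.univ.sup fun i => depth (ts i)

/-- The immediate subterm at position `i ∈ ℕ`, positions being numbered from `1`; `none` if `i` is
not a position of the term. -/
def child (t : L.Term V) (i : ℕ) : Option (L.Term V) :=
  match t with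
  | .var _ => none
  | .func (l := l) _ ts =>
    if h : 1 ≤ i ∧ i ≤ l then some (ts ⟨i - 1, by omega⟩) else none

/-- `u` matches `t`: some substitution (moving finitely many variables) sends `u` to `t`. -/
def Matches (u t : L.Term V) : Prop :=
  ∃ σ : V → L.Term V, {x | σ x ≠ FirstOrder.Language.Term.var x}.Finite ∧ u.subst σ = t

variable (L) in
/-- The largest arity of a function symbol. -/
noncomputable def maxArity : ℕ := sSup {n | Nonempty (L.Functions n)}

variable (L V) in
/-- Contexts (`□`-terms): terms with exactly one occurrence of the hole `□`. In
`func f i c ts` the hole lies in the `i`-th argument `c`; `ts` lists the other arguments. -/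
inductive Ctx : Type (max u w)
  | hole : Ctx
  | func {n : ℕ} (f : L.Functions n) (i : Fin n) (c : Ctx)
      (ts : {j : Fin n // j ≠ i} → L.Term V) : Ctx

/-- `τ · τ' = τ[τ']`: the hole of `τ` is replaced by `τ'`. -/
def Ctx.comp : Ctx L V → Ctx L V → Ctx L V
  | .hole, τ' => τ'
  | .func f i c ts, τ' => .func f i (c.comp τ') ts

/-- Merging of two optional contexts: `τ · τ'` if both are present, and the one that is present
otherwise. -/
def mergeOpt : Option (Ctx L V) → Option (Ctx L V) → Option (Ctx L V)
  | some τ, some τ' => some (τ.comp τ')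
  | some τ, none => some τ
  | none, τ' => τ'

end Terms

/-! ## Position-based strategies -/

variable (L : FirstOrder.Language.{u, v}) (V : Type w)

/-- A (well-founded) position-based strategy `[@p₁.τ₁, …, @pₙ.τₙ]`: the positions are pairwise
distinct, and insertions at lower positions come earlier (no `pᵢ` is strictly above, i.e. a strict
prefix of, a later `pⱼ`). The empty list is the failing strategy `∅`. -/
structure PosCE where
  entries : List (List ℕ × Ctx L V)
  nodup : (entries.map Prod.fst).Nodup
  ordered : entries.Pairwise fun a b => ¬ (a.1 <+: b.1 ∧ a.1 ≠ b.1)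

variable {L V}

namespace PosCE

/-- Equality of position-based strategies is equality of the lists up to a permutation. (Two
well-founded lists that are permutations of each other differ only by the order of parallel
positions.) -/
instance : Setoid (PosCE L V) where
  r E E' := E.entries.Perm E'.entries
  iseqv := ⟨fun _ => .refl _, fun h => h.symm, fun h h' => h.trans h'⟩

/-- The failing strategy. -/
def fail : PosCE L V := ⟨[], by simp, by simp⟩

/-- The list underlying `meet`. -/
def meetList (I : Finset ℕ) (E : {i // i ∈ I} → PosCE L V) (τ : Option (Ctx L V)) :
    List (List ℕ × Ctx L V) :=
  ((I.sort (· ≤ ·)).attach.flatMap fun i =>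
    (E ⟨i.1, (Finset.mem_sort _).1 i.2⟩).entries.map fun e => (i.1 :: e.1, e.2)) ++
  τ.toList.map fun τ => ([], τ)

theorem meetList_pairwise (I : Finset ℕ) (E : {i // i ∈ I} → PosCE L V) (τ : Option (Ctx L V)) :
    (meetList I E τ).Pairwise fun a b => a.1 ≠ b.1 ∧ ¬ (a.1 <+: b.1 ∧ a.1 ≠ b.1) := by
  unfold meetList
  rw [List.pairwise_append]
  refine ⟨?_, ?_, ?_⟩
  · rw [List.pairwise_flatMap]
    refine ⟨?_, ?_⟩
    · intro i _
      rw [List.pairwise_map]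
      have h1 := (E ⟨i.1, (Finset.mem_sort _).1 i.2⟩).nodup
      have h2 := (E ⟨i.1, (Finset.mem_sort _).1 i.2⟩).ordered
      rw [List.Nodup, List.pairwise_map] at h1
      refine (h1.and h2).imp ?_
      rintro a b ⟨hab, hab'⟩
      simpa [List.cons_prefix_cons] using ⟨hab, fun h => by simpa using fun h' => hab' ⟨h, h'⟩⟩
    · have hn : (I.sort (· ≤ ·)).attach.Pairwise (· ≠ ·) :=
        (List.nodup_attach.2 (Finset.sort_nodup _ _))
      refine hn.imp ?_
      intro i j hij a ha b hb
      simp only [List.mem_map] at ha hb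
      obtain ⟨a', _, rfl⟩ := ha
      obtain ⟨b', _, rfl⟩ := hb
      have : i.1 ≠ j.1 := fun h => hij (Subtype.ext h)
      simp [List.cons_prefix_cons, this]
  · cases τ <;> simp
  · intro a ha b hb
    simp only [List.mem_flatMap, List.mem_map] at ha hb
    obtain ⟨i, _, a', _, rfl⟩ := ha
    obtain ⟨b', _, rfl⟩ := hb
    simp

/-- `[@i.Eᵢ (i ∈ I), @ε.τ]`, where `@i.[@p₁.τ₁, …] = [@(i p₁).τ₁, …]` and the last component may be
absent (`τ = none`). The lists are flattened; in particular failing components disappear, and the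
result is `∅` when all components fail. -/
def meet (I : Finset ℕ) (E : {i // i ∈ I} → PosCE L V) (τ : Option (Ctx L V)) : PosCE L V where
  entries := meetList I E τ
  nodup := by
    rw [List.Nodup, List.pairwise_map]
    exact (meetList_pairwise I E τ).imp And.left
  ordered := (meetList_pairwise I E τ).imp And.right

/-- The insertions of `E` and `E'` together, in no particular order: at a common position `p` the
contexts `τ` of `E` and `τ'` of `E'` are merged into `τ · τ'`, all other insertions are kept. -/
def unifyList (E E' : PosCE L V) : List (List ℕ × Ctx L V) :=
  (E.entries.map fun e =>
    (e.1, match E'.entries.lookup e.1 with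
      | some τ' => e.2.comp τ'
      | none => e.2)) ++
  E'.entries.filter fun e => (E.entries.lookup e.1).isNone

theorem unifyList_nodup (E E' : PosCE L V) : ((unifyList E E').map Prod.fst).Nodup := by
  unfold unifyList
  rw [List.map_append, List.nodup_append']
  refine ⟨by simpa [List.map_map, Function.comp_def] using E.nodup,
    E'.nodup.sublist (List.filter_sublist.map _), ?_⟩
  intro p hp hp'
  simp only [List.mem_map, List.mem_filter, Option.isNone_iff_eq_none, List.lookup_eq_none_iff] at *
  obtain ⟨_, ⟨e, he, rfl⟩, rfl⟩ := hp
  obtain ⟨e', ⟨_, h⟩, h'⟩ := hp'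
  have := h e he
  simp [h'] at this

/-- The unification `E ⊓ E'` of position-based strategies: `∅` if one of them is `∅`; otherwise the
merged insertions, sorted so that lower (longer) positions come first. -/
def unify (E E' : PosCE L V) : PosCE L V where
  entries :=
    if E.entries = [] ∨ E'.entries = [] then []
    else (unifyList E E').mergeSort fun a b => decide (b.1.length ≤ a.1.length)
  nodup := by
    split_ifs
    · simp
    · exact ((List.mergeSort_perm _ _).map _).nodup_iff.2 (unifyList_nodup E E')
  ordered := by
    split_ifs
    · simp
    · refine (List.pairwise_mergeSort (le := fun a b : List ℕ × Ctx L V =>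
        decide (b.1.length ≤ a.1.length)) ?_ ?_ (unifyList E E')).imp ?_
      · intro a b c hab hbc
        simp only [decide_eq_true_eq] at *
        omega
      · intro a b
        simp only [Bool.or_eq_true, decide_eq_true_eq]
        omega
      · rintro a b hab ⟨h, hne⟩
        simp only [decide_eq_true_eq] at hab
        exact hne (h.eq_of_length_le hab)

end PosCE

/-! ## Context-embedding strategies -/

variable (L V) in
/-- Context-embedding strategies. Fixed-point variables are natural numbers.
* `fail` is `∅`, `var X` is `X`, `guard u S` is `u;S`, `choice S S'` is `S ⊕ S'`, `mu X S` is
  `μX.S`, `most S` is `Most(S)`, `cond S S'` is `If S Then S'`;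
* `list I S τ` is `[@i.Sᵢ (i ∈ I), @ε.τ]`, the last component being absent if `τ = none`. -/
inductive CE : Type (max u w)
  | fail : CE
  | var (X : ℕ) : CE
  | list (I : Finset ℕ) (S : {i // i ∈ I} → CE) (τ : Option (Ctx L V)) : CE
  | guard (u : L.Term V) (S : CE) : CE
  | choice (S S' : CE) : CE
  | mu (X : ℕ) (S : CE) : CE
  | most (S : CE) : CE
  | cond (S S' : CE) : CE

namespace CE

/-- The insertion `@ε.τ`. -/
def ins (τ : Ctx L V) : CE L V := .list ∅ (fun i => (Finset.notMem_empty _ i.2).elim) (some τ)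

/-- The jump `@i.S`, `i ∈ ℕ`. -/
def jump (i : ℕ) (S : CE L V) : CE L V := .list {i} (fun _ => S) none

/-- `X` is free in `S`. -/
def FreeIn (X : ℕ) : CE L V → Prop
  | .fail => False
  | .var Y => Y = X
  | .list _ S _ => ∃ i, (S i).FreeIn X
  | .guard _ S => S.FreeIn X
  | .choice S S' => S.FreeIn X ∨ S'.FreeIn X
  | .mu Y S => Y ≠ X ∧ S.FreeIn X
  | .most S => S.FreeIn X
  | .cond S S' => S.FreeIn X ∨ S'.FreeIn X

/-- All fixed-point variables are bound. -/
def Closed (S : CE L V) : Prop := ∀ X, ¬ S.FreeIn X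

/-- `X` occurs in `S`, free, bound or as a binder. -/
def Occurs (X : ℕ) : CE L V → Prop
  | .fail => False
  | .var Y => Y = X
  | .list _ S _ => ∃ i, (S i).Occurs X
  | .guard _ S => S.Occurs X
  | .choice S S' => S.Occurs X ∨ S'.Occurs X
  | .mu Y S => Y = X ∨ S.Occurs X
  | .most S => S.Occurs X
  | .cond S S' => S.Occurs X ∨ S'.Occurs X

/-- Every free occurrence of `X` in `S` lies below some jump `@i.` with `i ∈ ℕ` (so `i ≠ ε`) or
below some `Most`. -/
def Guarded (X : ℕ) : CE L V → Prop
  | .fail => True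
  | .var Y => Y ≠ X
  | .list _ _ _ => True
  | .guard _ S => S.Guarded X
  | .choice S S' => S.Guarded X ∧ S'.Guarded X
  | .mu Y S => Y = X ∨ S.Guarded X
  | .most _ => True
  | .cond S S' => S.Guarded X ∧ S'.Guarded X

/-- In each fixed point `μX.S'` inside `S`, between the binder and every occurrence of `X` bound by
it there is a jump to a position `i ∈ ℕ` or a `Most`. -/
def Monotonic : CE L V → Prop
  | .fail => True
  | .var _ => True
  | .list _ S _ => ∀ i, (S i).Monotonic
  | .guard _ S => S.Monotonic
  | .choice S S' => S.Monotonic ∧ S'.Monotonic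
  | .mu X S => S.Guarded X ∧ S.Monotonic
  | .most S => S.Monotonic
  | .cond S S' => S.Monotonic ∧ S'.Monotonic

/-- `S(R)`: the free occurrences of `X` in `S` are replaced by `R`. It is only used for closed `R`,
so no variable can be captured. -/
def subst (X : ℕ) : CE L V → CE L V → CE L V
  | .fail, _ => .fail
  | .var Y, R => if Y = X then R else .var Y
  | .list I S τ, R => .list I (fun i => (S i).subst X R) τ
  | .guard u S, R => .guard u (S.subst X R)
  | .choice S S', R => .choice (S.subst X R) (S'.subst X R)
  | .mu Y S, R => if Y = X then .mu Y S else .mu Y (S.subst X R)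
  | .most S, R => .most (S.subst X R)
  | .cond S S', R => .cond (S.subst X R) (S'.subst X R)

/-- `μⁿX.S`: `μ⁰X.S = ∅` and `μⁿ⁺¹X.S = S(μⁿX.S)`. -/
def iterate (X : ℕ) (S : CE L V) : ℕ → CE L V
  | 0 => .fail
  | n + 1 => S.subst X (iterate X S n)

/-! ### From strategies to position-based strategies -/

open Classical in
/-- Auxiliary form of `Ψ` for strategies with free variables: the position-based strategy of `S` at
the term `t`, when the free variable `X` stands for `t ↦ ρ X t`. At `μX.S` the body is iterated
`depth t` times from the failing strategy; that this is `Ψ_t(μ^{depth t}X.S)` is `psi_mu` below. -/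
noncomputable def psiAux : CE L V → (ℕ → L.Term V → PosCE L V) → L.Term V → PosCE L V
  | .fail, _, _ => .fail
  | .var X, ρ, t => ρ X t
  | .list I S τ, ρ, t =>
      .meet I (fun i => match child t i.1 with
        | some t' => (S i).psiAux ρ t'
        | none => .fail) τ
  | .guard u S, ρ, t => if Matches u t then S.psiAux ρ t else .fail
  | .choice S S', ρ, t =>
      if (S.psiAux ρ t).entries ≠ [] then S.psiAux ρ t else S'.psiAux ρ t
  | .mu X S, ρ, t =>
      ((fun g : L.Term V → PosCE L V => S.psiAux (Function.update ρ X g))^[depth t]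
        fun _ => .fail) t
  | .most S, ρ, t =>
      .meet (Finset.Icc 1 (arity t)) (fun i => match child t i.1 with
        | some t' => S.psiAux ρ t'
        | none => .fail) none
  | .cond S S', ρ, t => if (S.psiAux ρ t).entries ≠ [] then S'.psiAux ρ t else .fail

/-- `Ψ_t(S)`, for closed `S`: the position-based strategy that `S` amounts to on the term `t`. (No
variable is looked up when `S` is closed.) -/
noncomputable def psi (t : L.Term V) (S : CE L V) : PosCE L V := S.psiAux (fun _ _ => .fail) t

/-! The clauses that determine `Ψ` on closed strategies. -/

theorem psi_fail (t : L.Term V) : psi t (.fail : CE L V) = .fail := rfl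

theorem psi_list (t : L.Term V) (I : Finset ℕ) (S : {i // i ∈ I} → CE L V)
    (τ : Option (Ctx L V)) :
    psi t (.list I S τ) = .meet I (fun i => match child t i.1 with
      | some t' => psi t' (S i)
      | none => .fail) τ := rfl

open Classical in
theorem psi_guard (t u : L.Term V) (S : CE L V) :
    psi t (.guard u S) = if Matches u t then psi t S else .fail := rfl

open Classical in
theorem psi_choice (t : L.Term V) (S S' : CE L V) :
    psi t (.choice S S') = if (psi t S).entries ≠ [] then psi t S else psi t S' := rfl

theorem psi_most (t : L.Term V) (S : CE L V) :
    psi t (.most S) = psi t (.list (Finset.Icc 1 (arity t)) (fun _ => S) none) := rfl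

open Classical in
theorem psi_cond (t : L.Term V) (S S' : CE L V) :
    psi t (.cond S S') = if (psi t S).entries ≠ [] then psi t S' else .fail := rfl

theorem psiAux_congr (S : CE L V) : ∀ ρ ρ' : ℕ → L.Term V → PosCE L V,
    (∀ X, S.FreeIn X → ρ X = ρ' X) → S.psiAux ρ = S.psiAux ρ' := by
  induction S with
  | fail => intros; rfl
  | var X => intro ρ ρ' h; funext t; simp [psiAux, h X rfl]
  | list I S τ ih =>
    intro ρ ρ' h; funext t
    simp only [psiAux]
    congr 1; funext i
    rw [ih i ρ ρ' fun X hX => h X ⟨i, hX⟩]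
  | guard u S ih => intro ρ ρ' h; funext t; simp only [psiAux, ih ρ ρ' h]
  | choice S S' ih ih' =>
    intro ρ ρ' h; funext t
    simp only [psiAux, ih ρ ρ' fun X hX => h X (.inl hX), ih' ρ ρ' fun X hX => h X (.inr hX)]
  | mu X S ih =>
    intro ρ ρ' h; funext t
    simp only [psiAux]
    refine congrFun (congrFun (congrArg (fun f => Nat.iterate f (depth t)) (funext fun g => ?_)) _) t
    apply ih
    intro Y hY
    by_cases hXY : Y = X
    · subst hXY; simp
    · simp [hXY, h Y ⟨Ne.symm hXY, hY⟩]
  | most S ih => intro ρ ρ' h; funext t; simp only [psiAux, ih ρ ρ' h]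
  | cond S S' ih ih' =>
    intro ρ ρ' h; funext t
    simp only [psiAux, ih ρ ρ' fun X hX => h X (.inl hX), ih' ρ ρ' fun X hX => h X (.inr hX)]

theorem psiAux_subst (X : ℕ) (R : CE L V) (hR : R.Closed) (S : CE L V) :
    ∀ ρ : ℕ → L.Term V → PosCE L V,
      (S.subst X R).psiAux ρ = S.psiAux (Function.update ρ X (R.psiAux ρ)) := by
  induction S with
  | fail => intros; rfl
  | var Y =>
    intro ρ; funext t
    by_cases h : Y = X
    · subst h; simp [subst, psiAux]
    · simp [subst, psiAux, h]
  | list I S τ ih => intro ρ; funext t; simp only [subst, psiAux, ih]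
  | guard u S ih => intro ρ; funext t; simp only [subst, psiAux, ih]
  | choice S S' ih ih' => intro ρ; funext t; simp only [subst, psiAux, ih, ih']
  | mu Y S ih =>
    intro ρ
    by_cases h : Y = X
    · subst h; funext t; simp [subst, psiAux]
    · funext t
      simp only [subst, h, if_false, psiAux]
      refine congrFun (congrFun (congrArg (fun f => Nat.iterate f (depth t)) (funext fun g => ?_)) _) t
      rw [ih, Function.update_comm (Ne.symm h),
        psiAux_congr R _ ρ fun Z hZ => (hR Z hZ).elim]
  | most S ih => intro ρ; funext t; simp only [subst, psiAux, ih]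
  | cond S S' ih ih' => intro ρ; funext t; simp only [subst, psiAux, ih, ih']

theorem FreeIn_subst {X Y : ℕ} {R : CE L V} (hR : R.Closed) (S : CE L V)
    (h : (S.subst X R).FreeIn Y) : Y ≠ X ∧ S.FreeIn Y := by
  induction S with
  | fail => exact h.elim
  | var Z =>
    by_cases hZ : Z = X
    · simp only [subst, hZ, if_true] at h; exact (hR _ h).elim
    · simp only [subst, hZ, if_false] at h
      exact ⟨fun h' => hZ (Eq.trans h h'), h⟩
  | list I S τ ih => obtain ⟨i, hi⟩ := h; exact ⟨(ih i hi).1, i, (ih i hi).2⟩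
  | guard u S ih => exact ih h
  | choice S S' ih ih' =>
    rcases h with h | h
    · exact ⟨(ih h).1, .inl (ih h).2⟩
    · exact ⟨(ih' h).1, .inr (ih' h).2⟩
  | mu Z S ih =>
    by_cases hZ : Z = X
    · simp only [subst, hZ, if_true] at h
      exact ⟨Ne.symm h.1, by rw [hZ]; exact h⟩
    · simp only [subst, hZ, if_false] at h
      exact ⟨(ih h.2).1, h.1, (ih h.2).2⟩
  | most S ih => exact ih h
  | cond S S' ih ih' =>
    rcases h with h | h
    · exact ⟨(ih h).1, .inl (ih h).2⟩
    · exact ⟨(ih' h).1, .inr (ih' h).2⟩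

theorem iterate_closed {X : ℕ} {S : CE L V} (h : (CE.mu X S).Closed) (n : ℕ) :
    (iterate X S n).Closed := by
  induction n with
  | zero => exact fun _ h => h
  | succ n ih => exact fun Y hY => h Y ⟨(FreeIn_subst ih S hY).1.symm, (FreeIn_subst ih S hY).2⟩

theorem psi_mu (t : L.Term V) (X : ℕ) (S : CE L V) (h : (CE.mu X S).Closed) :
    psi t (.mu X S) = psi t (iterate X S (depth t)) := by
  have key : ∀ n : ℕ,
      ((fun g : L.Term V → PosCE L V => S.psiAux (Function.update (fun _ _ => .fail) X g))^[n]
        fun _ => .fail) = (iterate X S n).psiAux fun _ _ => .fail := by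
    intro n
    induction n with
    | zero => rfl
    | succ n ih =>
      rw [Function.iterate_succ_apply', ih, iterate, psiAux_subst X _ (iterate_closed h n)]
  simp only [psi, psiAux]
  rw [key]

end CE

/-! ## The unification system -/

variable (L V) in
/-- Memories: sets of triples `(S, S', Z)`. -/
abbrev Memory : Type (max u w) := Set (CE L V × CE L V × ℕ)

variable (L V) in
/-- Pre-strategies: they are built like strategies, from strategies and tuples `⟨S, S', M⟩`. (The
condition of `If S Then P` is always a strategy.) -/
inductive PreCE : Type (max u w)
  | fail : PreCE
  | var (X : ℕ) : PreCE
  | list (I : Finset ℕ) (P : {i // i ∈ I} → PreCE) (τ : Option (Ctx L V)) : PreCE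
  | guard (u : L.Term V) (P : PreCE) : PreCE
  | choice (P P' : PreCE) : PreCE
  | mu (X : ℕ) (P : PreCE) : PreCE
  | most (P : PreCE) : PreCE
  | cond (S : CE L V) (P : PreCE) : PreCE
  | tuple (S S' : CE L V) (M : Memory L V) : PreCE

/-- Strategies are pre-strategies. -/
def CE.toPre : CE L V → PreCE L V
  | .fail => .fail
  | .var X => .var X
  | .list I S τ => .list I (fun i => (S i).toPre) τ
  | .guard u S => .guard u S.toPre
  | .choice S S' => .choice S.toPre S'.toPre
  | .mu X S => .mu X S.toPre
  | .most S => .most S.toPre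
  | .cond S S' => .cond S S'.toPre

/-- `Z` is a fresh variable for the pair `S, S'` and the memory `M`. -/
def Fresh (Z : ℕ) (S S' : CE L V) (M : Memory L V) : Prop :=
  ¬ S.Occurs Z ∧ ¬ S'.Occurs Z ∧
    ∀ A B Y, (A, B, Y) ∈ M → ¬ A.Occurs Z ∧ ¬ B.Occurs Z ∧ Y ≠ Z

/-- `Rule k S S' M P`: the `k`-th reduction rule rewrites the tuple `⟨S, S', M⟩` to `P`, priorities
being disregarded. -/
inductive Rule : ℕ → CE L V → CE L V → Memory L V → PreCE L V → Prop
  | fail_left (S M) : Rule 0 .fail S M .fail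
  | fail_right (S M) : Rule 1 S .fail M .fail
  | ins_ins (τ τ' M) : Rule 2 (.ins τ) (.ins τ') M (CE.ins (τ.comp τ')).toPre
  | guard_left (u S S' M) : Rule 3 (.guard u S) S' M (.guard u (.tuple S S' M))
  | guard_right (u S S' M) : Rule 4 S' (.guard u S) M (.guard u (.tuple S' S M))
  | jump_jump (i S S' M) :
      Rule 5 (.jump i S) (.jump i S') M (.list {i} (fun _ => .tuple S S' M) none)
  | list_list (I J) (S : {i // i ∈ I} → CE L V) (S' : {j // j ∈ J} → CE L V) (τ τ' M) :
      Rule 6 (.list I S τ) (.list J S' τ') M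
        (.cond (.list I S τ) (.cond (.list J S' τ')
          (.list (I ∪ J)
            (fun i =>
              if hI : i.1 ∈ I then
                if hJ : i.1 ∈ J then
                  .choice (.tuple (S ⟨i, hI⟩) (S' ⟨i, hJ⟩) M)
                    (.choice (S ⟨i, hI⟩).toPre (S' ⟨i, hJ⟩).toPre)
                else (S ⟨i, hI⟩).toPre
              else (S' ⟨i, (Finset.mem_union.1 i.2).resolve_left hI⟩).toPre)
            (mergeOpt τ τ'))))
  | choice_left (S₁ S₂ S M) :
      Rule 7 (.choice S₁ S₂) S M (.choice (.tuple S₁ S M) (.tuple S₂ S M))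
  | choice_right (S₁ S₂ S M) :
      Rule 8 S (.choice S₁ S₂) M (.choice (.tuple S S₁ M) (.tuple S S₂ M))
  | cond_left (S₁ S₂ S M) : Rule 9 (.cond S₁ S₂) S M (.cond S₁ (.tuple S₂ S M))
  | cond_right (S₁ S₂ S M) : Rule 10 S (.cond S₁ S₂) M (.cond S₁ (.tuple S S₂ M))
  | most_most (S S' M) :
      Rule 11 (.most S) (.most S') M
        (.cond (.most S) (.cond (.most S')
          (.most (.choice (.tuple S S' M) (.choice S.toPre S'.toPre)))))
  | most_list (S I) (S' : {i // i ∈ I} → CE L V) (τ M) :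
      Rule 12 (.most S) (.list I S' τ) M
        (.tuple (.list (Finset.Icc 1 (maxArity L)) (fun _ => S) none) (.list I S' τ) M)
  | list_most (I) (S' : {i // i ∈ I} → CE L V) (τ S M) :
      Rule 13 (.list I S' τ) (.most S) M
        (.tuple (.list I S' τ) (.list (Finset.Icc 1 (maxArity L)) (fun _ => S) none) M)
  | mu_left_unfold (X S S' M Z) (hM : ∀ Y, (CE.mu X S, S', Y) ∉ M)
      (hZ : Fresh Z (.mu X S) S' M) :
      Rule 14 (.mu X S) S' M
        (.mu Z (.tuple (S.subst X (.mu X S)) S' (M ∪ {(.mu X S, S', Z)})))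
  | mu_left_memory (X S S' M Z) (hM : (CE.mu X S, S', Z) ∈ M) :
      Rule 14 (.mu X S) S' M (.var Z)
  | mu_right_unfold (X S S' M Z) (hM : ∀ Y, (S', CE.mu X S, Y) ∉ M)
      (hZ : Fresh Z S' (.mu X S) M) :
      Rule 15 S' (.mu X S) M
        (.mu Z (.tuple S' (S.subst X (.mu X S)) (M ∪ {(S', .mu X S, Z)})))
  | mu_right_memory (X S S' M Z) (hM : (S', CE.mu X S, Z) ∈ M) :
      Rule 15 S' (.mu X S) M (.var Z)

/-- One reduction step of the unification system: some tuple inside a pre-strategy is rewritten by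
the applicable rule of highest priority (smallest number). -/
inductive Step : PreCE L V → PreCE L V → Prop
  | tuple {k S S' M P} (h : Rule k S S' M P) (hk : ∀ j < k, ∀ Q, ¬ Rule j S S' M Q) :
      Step (.tuple S S' M) P
  | list {I P τ} (i : {i // i ∈ I}) {Q} (h : Step (P i) Q) :
      Step (.list I P τ) (.list I (Function.update P i Q) τ)
  | guard {u P Q} (h : Step P Q) : Step (.guard u P) (.guard u Q)
  | choice_left {P P' Q} (h : Step P Q) : Step (.choice P P') (.choice Q P')
  | choice_right {P P' Q} (h : Step P' Q) : Step (.choice P P') (.choice P Q)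
  | mu {X P Q} (h : Step P Q) : Step (.mu X P) (.mu X Q)
  | most {P Q} (h : Step P Q) : Step (.most P) (.most Q)
  | cond {S P Q} (h : Step P Q) : Step (.cond S P) (.cond S Q)

/-- `N` is a normal form of `P` with respect to the unification system. -/
def IsNormalForm (P N : PreCE L V) : Prop :=
  Relation.ReflTransGen Step P N ∧ ∀ Q, ¬ Step N Q

end CES

namespace CES

universe u v w

variable {L : FirstOrder.Language.{u, v}} {V : Type w}

/-! Soundness and termination are proved independently and meet in the big-step relation `Unifies`,
which forgets priorities and the order of steps.

Soundness. Up to permutation, a position-based strategy is a finite partial map from positions to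
contexts (`PosCE.get`), and unification is pointwise merging, except that it fails as soon as one
side fails. Every rule that does not concern fixed points then becomes an identity about merging.
For fixed points, monotonicity makes the value of `μX.S` at `t` depend on `X` only at terms of
strictly smaller depth (`psiAux_local`). The iteration is therefore stationary at `t` from stage
`depth t` on, and a fixed point has the same value as its unfolding (`psi_unfold`).

The delicate point is a variable `Z` produced from the memory: it is meant to denote the unification
of the pair it abbreviates, which looks circular. The circle is broken by a lexicographic measure. A
jump or a `Most` lowers the depth of the term; an unfolding keeps the term but lowers `unfoldings`,
the number of fixed points reachable without a jump. `Memory.Sound` asks for correctness of the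
memory only below the current measure. When `μZ` is introduced, its own pair is above the measure of
the body at the same depth, so `Z` matters only at smaller depths and an induction on approximation
stages closes the argument (`psiAux_mu_equiv_unify`, `Unifies.sound`).

Every normal form. A tuple of closed strategies with finite memory always admits a step, so a normal
form contains no tuple and is a strategy. Results of unification pull back along steps
(`Step.realizes`), so any normal form of the initial tuple is related to it by `Unifies`, whatever
reduction and fresh variables were used. Its free variables come from the memory, which is empty at
the start.

Existence. As in the Fischer–Ladner closure of a fixed-point formula, a closed strategy generates
only finitely many strategies under the rules (`exists_finite_succ_closed`). Each unfolding records
a new pair from a finite set in the memory, and between unfoldings the total size decreases, so a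
lexicographic induction yields a normal form (`normalizes_tuple`). -/

theorem lookup_eq_some_iff_mem {l : List (List ℕ × Ctx L V)} (h : (l.map Prod.fst).Nodup)
    {p : List ℕ} {τ : Ctx L V} : l.lookup p = some τ ↔ (p, τ) ∈ l := by
  induction l with
  | nil => simp
  | cons e l ih =>
    obtain ⟨q, σ⟩ := e
    simp only [List.map_cons, List.nodup_cons] at h
    by_cases hpq : p = q
    · subst hpq
      have : (p, τ) ∉ l := fun hm => h.1 (List.mem_map_of_mem (f := Prod.fst) hm)
      simp [this, eq_comm]
    · have : (p == q) = false := by simpa using hpq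
      simp [List.lookup_cons, this, hpq, ih h.2]

/-! ### Position-based strategies as finite partial maps -/

namespace PosCE

/-- The context that a position-based strategy inserts at the position `p`, if any. -/
def get (E : PosCE L V) (p : List ℕ) : Option (Ctx L V) := E.entries.lookup p

theorem get_eq_some {E : PosCE L V} {p : List ℕ} {τ : Ctx L V} :
    E.get p = some τ ↔ (p, τ) ∈ E.entries := lookup_eq_some_iff_mem E.nodup

/-- Positions are distinct, so neither list has duplicates; permutation then amounts to having the
same members, and membership is what lookup records. All later equivalences are checked position by
position through this. -/
theorem equiv_iff_get {E E' : PosCE L V} : E ≈ E' ↔ ∀ p, E.get p = E'.get p := by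
  change E.entries.Perm E'.entries ↔ _
  rw [List.perm_ext_iff_of_nodup E.nodup.of_map E'.nodup.of_map]
  constructor
  · intro h p
    ext τ
    rw [get_eq_some, get_eq_some, h]
  · rintro h ⟨p, τ⟩
    rw [← get_eq_some, ← get_eq_some, h]

theorem entries_eq_nil_iff {E : PosCE L V} : E.entries = [] ↔ ∀ p, E.get p = none := by
  rw [List.eq_nil_iff_forall_not_mem]
  constructor
  · intro h p
    rw [Option.eq_none_iff_forall_not_mem]
    exact fun τ hτ => h (p, τ) (get_eq_some.1 hτ)
  · rintro h ⟨p, τ⟩ hm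
    rw [← get_eq_some, h] at hm
    cases hm

theorem entries_eq_nil_congr {E E' : PosCE L V} (h : E ≈ E') :
    E.entries = [] ↔ E'.entries = [] := by
  simp only [entries_eq_nil_iff, equiv_iff_get.1 h]

@[simp] theorem get_fail (p : List ℕ) : (fail : PosCE L V).get p = none := rfl

@[simp] theorem get_meet_nil (I : Finset ℕ) (E : {i // i ∈ I} → PosCE L V) (τ : Option (Ctx L V)) :
    (meet I E τ).get [] = τ := by
  ext σ
  rw [get_eq_some]
  simp [meet, meetList, eq_comm]

theorem get_meet_cons (I : Finset ℕ) (E : {i // i ∈ I} → PosCE L V) (τ : Option (Ctx L V))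
    (i : ℕ) (p : List ℕ) :
    (meet I E τ).get (i :: p) = if h : i ∈ I then (E ⟨i, h⟩).get p else none := by
  ext σ
  rw [get_eq_some]
  by_cases h : i ∈ I
  · simp only [meet, meetList, h, dif_pos, get_eq_some]
    simp only [List.mem_append, List.mem_flatMap, List.mem_map, List.mem_attach, true_and]
    constructor
    · rintro (⟨⟨j, hj⟩, ⟨q, υ⟩, hm, heq⟩ | ⟨_, _, heq⟩)
      · simp only [Prod.mk.injEq, List.cons.injEq] at heq
        obtain ⟨⟨rfl, rfl⟩, rfl⟩ := heq
        exact hm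
      · simp at heq
    · exact fun hm => .inl ⟨⟨i, (Finset.mem_sort _).2 h⟩, _, hm, rfl⟩
  · simp only [h, dif_neg, not_false_eq_true, reduceCtorEq, iff_false]
    simp only [meet, meetList, List.mem_append, List.mem_flatMap, List.mem_map, List.mem_attach,
      true_and]
    rintro (⟨⟨j, hj⟩, ⟨q, υ⟩, _, heq⟩ | ⟨_, _, heq⟩)
    · simp only [Prod.mk.injEq, List.cons.injEq] at heq
      obtain ⟨⟨rfl, rfl⟩, rfl⟩ := heq
      exact h ((Finset.mem_sort _).1 hj)
    · simp at heq

theorem mem_unifyList {E E' : PosCE L V} {p : List ℕ} {τ : Ctx L V} :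
    (p, τ) ∈ unifyList E E' ↔ mergeOpt (E.get p) (E'.get p) = some τ := by
  simp only [unifyList, List.mem_append, List.mem_map, List.mem_filter, Prod.mk.injEq]
  constructor
  · rintro (⟨⟨q, σ⟩, hm, rfl, rfl⟩ | ⟨hm, hn⟩)
    · rw [get_eq_some.2 hm]
      change _ = some (match E'.get q with | some τ' => σ.comp τ' | none => σ)
      cases E'.get q <;> rfl
    · have h : E.get p = none := by simpa [get] using hn
      rw [h, get_eq_some.2 hm]
      rfl
  · intro h
    cases hE : E.get p with
    | none =>
      rw [hE] at h
      exact .inr ⟨get_eq_some.1 h, by simpa [get] using hE⟩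
    | some σ =>
      refine .inl ⟨(p, σ), get_eq_some.1 hE, rfl, ?_⟩
      rw [hE] at h
      change (match E'.get p with | some τ' => σ.comp τ' | none => σ) = τ
      cases hE' : E'.get p <;> rw [hE'] at h <;> exact Option.some.inj h

theorem entries_unify_of_fails {E E' : PosCE L V} (h : E.entries = [] ∨ E'.entries = []) :
    (unify E E').entries = [] := by simp [unify, h]

theorem get_unify_of_fails {E E' : PosCE L V} (h : E.entries = [] ∨ E'.entries = [])
    (p : List ℕ) : (unify E E').get p = none :=
  entries_eq_nil_iff.1 (entries_unify_of_fails h) p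

theorem get_unify {E E' : PosCE L V} (h : E.entries ≠ []) (h' : E'.entries ≠ []) (p : List ℕ) :
    (unify E E').get p = mergeOpt (E.get p) (E'.get p) := by
  ext τ
  rw [get_eq_some, ← mem_unifyList]
  simp [unify, h, h']

theorem mergeOpt_eq_none {a b : Option (Ctx L V)} : mergeOpt a b = none ↔ a = none ∧ b = none := by
  cases a <;> cases b <;> simp [mergeOpt]

/-- Merging never discards a position, so failure can only come from the explicit failure clause.
This makes unification compatible with tests for failure, that is with choices and conditions. -/
theorem entries_unify_eq_nil {E E' : PosCE L V} :
    (unify E E').entries = [] ↔ E.entries = [] ∨ E'.entries = [] := by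
  refine ⟨fun h => ?_, entries_unify_of_fails⟩
  by_contra! hne
  refine hne.1 (entries_eq_nil_iff.2 fun p => ?_)
  have := entries_eq_nil_iff.1 h p
  rw [get_unify hne.1 hne.2, mergeOpt_eq_none] at this
  exact this.1

theorem unify_congr {E₁ E₂ E₁' E₂' : PosCE L V} (h : E₁ ≈ E₂) (h' : E₁' ≈ E₂') :
    unify E₁ E₁' ≈ unify E₂ E₂' := by
  rw [equiv_iff_get]
  intro p
  by_cases hf : E₁.entries = [] ∨ E₁'.entries = []
  · rw [get_unify_of_fails hf,
      get_unify_of_fails (by rwa [← entries_eq_nil_congr h, ← entries_eq_nil_congr h'])]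
  · have hf' := hf
    rw [entries_eq_nil_congr h, entries_eq_nil_congr h'] at hf'
    push Not at hf hf'
    rw [get_unify hf.1 hf.2, get_unify hf'.1 hf'.2, equiv_iff_get.1 h, equiv_iff_get.1 h']

theorem equiv_fail {E : PosCE L V} (h : E.entries = []) : E ≈ fail :=
  equiv_iff_get.2 fun p => entries_eq_nil_iff.1 h p

theorem fail_equiv_unify {E E' : PosCE L V} (h : E.entries = [] ∨ E'.entries = []) :
    fail ≈ unify E E' := (equiv_fail (entries_unify_of_fails h)).symm

open Classical in
/-- The first of two position-based strategies that does not fail. -/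
noncomputable def orElse (E E' : PosCE L V) : PosCE L V := if E.entries ≠ [] then E else E'

open Classical in
/-- The second strategy, provided that the first does not fail. -/
noncomputable def andThen (E E' : PosCE L V) : PosCE L V := if E.entries ≠ [] then E' else fail

theorem orElse_of_fails {E E' : PosCE L V} (h : E.entries = []) : orElse E E' = E' := by
  simp [orElse, h]

theorem orElse_of_ne {E E' : PosCE L V} (h : E.entries ≠ []) : orElse E E' = E := by
  simp [orElse, h]

theorem andThen_of_fails {E E' : PosCE L V} (h : E.entries = []) : andThen E E' = fail := by
  simp [andThen, h]

theorem andThen_of_ne {E E' : PosCE L V} (h : E.entries ≠ []) : andThen E E' = E' := by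
  simp [andThen, h]

theorem orElse_congr {E₁ E₂ E₁' E₂' : PosCE L V} (h : E₁ ≈ E₂) (h' : E₁' ≈ E₂') :
    orElse E₁ E₁' ≈ orElse E₂ E₂' := by
  by_cases hf : E₁.entries = []
  · rwa [orElse_of_fails hf, orElse_of_fails ((entries_eq_nil_congr h).1 hf)]
  · rwa [orElse_of_ne hf, orElse_of_ne (mt (entries_eq_nil_congr h).2 hf)]

theorem andThen_congr_right (E : PosCE L V) {E₁ E₂ : PosCE L V} (h : E₁ ≈ E₂) :
    andThen E E₁ ≈ andThen E E₂ := by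
  by_cases hf : E.entries = []
  · rw [andThen_of_fails hf, andThen_of_fails hf]
  · rwa [andThen_of_ne hf, andThen_of_ne hf]

/-- If `B` succeeds, `unify A B` fails exactly when `A` does, so the choice selects the same branch
before and after unification; if `B` fails, everything fails. -/
theorem orElse_unify (A A' B : PosCE L V) :
    orElse (unify A B) (unify A' B) ≈ unify (orElse A A') B := by
  by_cases hB : B.entries = []
  · rw [orElse_of_fails (entries_unify_of_fails (.inr hB))]
    exact (fail_equiv_unify (.inr hB)).symm.trans (fail_equiv_unify (.inr hB))
  by_cases hA : A.entries = []
  · rw [orElse_of_fails (entries_unify_of_fails (.inl hA)), orElse_of_fails hA]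
  · rw [orElse_of_ne (by simp [entries_unify_eq_nil, hA, hB]), orElse_of_ne hA]

theorem unify_orElse (A B B' : PosCE L V) :
    orElse (unify A B) (unify A B') ≈ unify A (orElse B B') := by
  by_cases hA : A.entries = []
  · rw [orElse_of_fails (entries_unify_of_fails (.inl hA))]
    exact (fail_equiv_unify (.inl hA)).symm.trans (fail_equiv_unify (.inl hA))
  by_cases hB : B.entries = []
  · rw [orElse_of_fails (entries_unify_of_fails (.inr hB)), orElse_of_fails hB]
  · rw [orElse_of_ne (by simp [entries_unify_eq_nil, hA, hB]), orElse_of_ne hB]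

theorem andThen_unify (A B B' : PosCE L V) :
    andThen A (unify B B') ≈ unify (andThen A B) B' := by
  by_cases hA : A.entries = []
  · rw [andThen_of_fails hA, andThen_of_fails hA]
    exact fail_equiv_unify (.inl rfl)
  · rw [andThen_of_ne hA, andThen_of_ne hA]

theorem unify_andThen (A B B' : PosCE L V) :
    andThen A (unify B B') ≈ unify B (andThen A B') := by
  by_cases hA : A.entries = []
  · rw [andThen_of_fails hA, andThen_of_fails hA]
    exact fail_equiv_unify (.inr rfl)
  · rw [andThen_of_ne hA, andThen_of_ne hA]

/-- Unifying two strategies where both succeed, and otherwise keeping the one that succeeds. -/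
theorem get_unify_orElse (A B : PosCE L V) (p : List ℕ) :
    (orElse (unify A B) (orElse A B)).get p = mergeOpt (A.get p) (B.get p) := by
  by_cases hA : A.entries = []
  · rw [orElse_of_fails (entries_unify_of_fails (.inl hA)), orElse_of_fails hA,
      entries_eq_nil_iff.1 hA p]
    rfl
  by_cases hB : B.entries = []
  · rw [orElse_of_fails (entries_unify_of_fails (.inr hB)), orElse_of_ne hA,
      entries_eq_nil_iff.1 hB p]
    cases A.get p <;> rfl
  · rw [orElse_of_ne (by simp [entries_unify_eq_nil, hA, hB]), get_unify hA hB]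

theorem meet_congr {I : Finset ℕ} {E E' : {i // i ∈ I} → PosCE L V} {τ : Option (Ctx L V)}
    (h : ∀ i, E i ≈ E' i) : meet I E τ ≈ meet I E' τ := by
  rw [equiv_iff_get]
  rintro (_ | ⟨i, p⟩)
  · simp
  · simp only [get_meet_cons]
    split_ifs with hi
    · exact equiv_iff_get.1 (h _) p
    · rfl

/-- Two position-based strategies are unified under the proviso that both succeed. -/
theorem andThen_andThen_equiv_unify {A B C : PosCE L V}
    (h : ∀ p, C.get p = mergeOpt (A.get p) (B.get p)) : andThen A (andThen B C) ≈ unify A B := by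
  by_cases hA : A.entries = []
  · rw [andThen_of_fails hA]
    exact fail_equiv_unify (.inl hA)
  by_cases hB : B.entries = []
  · rw [andThen_of_ne hA, andThen_of_fails hB]
    exact fail_equiv_unify (.inr hB)
  · rw [andThen_of_ne hA, andThen_of_ne hB, equiv_iff_get]
    intro p
    rw [h, get_unify hA hB]

theorem meet_singleton_entries_eq_nil {i : ℕ} {E : {j // j ∈ ({i} : Finset ℕ)} → PosCE L V} :
    (meet {i} E none).entries = [] ↔ (E ⟨i, Finset.mem_singleton_self i⟩).entries = [] := by
  simp only [entries_eq_nil_iff]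
  constructor
  · intro h p
    simpa [get_meet_cons] using h (i :: p)
  · rintro h (_ | ⟨j, p⟩)
    · simp
    · rw [get_meet_cons]
      split_ifs with hj
      · obtain rfl := Finset.mem_singleton.1 hj
        exact h p
      · rfl

/-- A single jump with no insertion at the root fails exactly when its component does, so failure is
the same above and below the jump. With several components this breaks down, which is why the rule
for general lists carries conditions and fallback choices. -/
theorem meet_singleton_unify (i : ℕ) (E E' : {j // j ∈ ({i} : Finset ℕ)} → PosCE L V) :
    meet {i} (fun j => unify (E j) (E' j)) none ≈ unify (meet {i} E none) (meet {i} E' none) := by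
  by_cases h : (E ⟨i, Finset.mem_singleton_self i⟩).entries = [] ∨
      (E' ⟨i, Finset.mem_singleton_self i⟩).entries = []
  · refine (equiv_fail (meet_singleton_entries_eq_nil.2 (entries_unify_of_fails h))).trans ?_
    exact fail_equiv_unify (h.imp meet_singleton_entries_eq_nil.2 meet_singleton_entries_eq_nil.2)
  · push Not at h
    rw [equiv_iff_get]
    intro p
    rw [get_unify (mt meet_singleton_entries_eq_nil.1 h.1) (mt meet_singleton_entries_eq_nil.1 h.2)]
    rcases p with _ | ⟨j, p⟩
    · simp [mergeOpt]
    · simp only [get_meet_cons]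
      split_ifs with hj
      · obtain rfl := Finset.mem_singleton.1 hj
        exact get_unify h.1 h.2 p
      · rfl

theorem meet_some_entries_ne_nil {I : Finset ℕ} {E : {i // i ∈ I} → PosCE L V} {τ : Ctx L V} :
    (meet I E (some τ)).entries ≠ [] := by
  rw [Ne, entries_eq_nil_iff]
  intro h
  simpa using h []

theorem meet_empty_unify (E E' E'' : {i // i ∈ (∅ : Finset ℕ)} → PosCE L V) (τ τ' : Ctx L V) :
    meet ∅ E'' (some (τ.comp τ')) ≈ unify (meet ∅ E (some τ)) (meet ∅ E' (some τ')) := by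
  rw [equiv_iff_get]
  intro p
  rw [get_unify meet_some_entries_ne_nil meet_some_entries_ne_nil]
  rcases p with _ | ⟨j, p⟩
  · simp [mergeOpt]
  · simp [get_meet_cons, mergeOpt]

end PosCE

/-! ### Depth, arity and evaluation at immediate subterms -/

theorem depth_pos (t : L.Term V) : 0 < depth t := by
  cases t <;> simp [depth]

theorem depth_child {t t' : L.Term V} {i : ℕ} (h : child t i = some t') : depth t' < depth t := by
  cases t with
  | var x => simp [child] at h
  | func f ts =>
    simp only [child] at h
    split_ifs at h with hi
    obtain rfl := Option.some.inj h
    have := Finset.le_sup (f := fun i => depth (ts i)) (Finset.mem_univ ⟨i - 1, by omega⟩)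
    simp only [depth] at this ⊢
    omega

theorem child_of_notMem {t : L.Term V} {i : ℕ} (h : i ∉ Finset.Icc 1 (arity t)) :
    child t i = none := by
  cases t with
  | var x => rfl
  | func f ts =>
    simp only [arity, Finset.mem_Icc] at h
    simp [child, h]

theorem arity_le_maxArity (hL : BddAbove {n | Nonempty (L.Functions n)}) (t : L.Term V) :
    arity t ≤ maxArity L := by
  cases t with
  | var x => simp [arity]
  | func f ts => exact le_csSup hL ⟨f⟩

/-- The value of `f` at the subterm in position `i`, and the failing strategy if there is none. -/
def atChild (t : L.Term V) (i : ℕ) (f : L.Term V → PosCE L V) : PosCE L V :=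
  match child t i with
  | some t' => f t'
  | none => .fail

theorem atChild_equiv {t : L.Term V} {i : ℕ} {f g : L.Term V → PosCE L V}
    (h : ∀ t', depth t' < depth t → f t' ≈ g t') : atChild t i f ≈ atChild t i g := by
  unfold atChild
  cases hc : child t i with
  | none => exact Setoid.refl _
  | some t' => exact h t' (depth_child hc)

theorem atChild_congr {t : L.Term V} {i : ℕ} {f g : L.Term V → PosCE L V}
    (h : ∀ t', depth t' < depth t → f t' = g t') : atChild t i f = atChild t i g := by
  unfold atChild
  cases hc : child t i with
  | none => rfl
  | some t' => exact h t' (depth_child hc)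

theorem atChild_unify (t : L.Term V) (i : ℕ) (f g : L.Term V → PosCE L V) :
    atChild t i (fun t' => (f t').unify (g t')) ≈ (atChild t i f).unify (atChild t i g) := by
  unfold atChild
  cases child t i with
  | none => exact PosCE.fail_equiv_unify (.inl rfl)
  | some t' => exact Setoid.refl _

theorem atChild_orElse (t : L.Term V) (i : ℕ) (f g : L.Term V → PosCE L V) :
    atChild t i (fun t' => (f t').orElse (g t')) = (atChild t i f).orElse (atChild t i g) := by
  unfold atChild
  cases child t i with
  | none => exact (PosCE.orElse_of_fails rfl).symm
  | some t' => rfl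

/-! ### Locality of evaluation, stabilisation of fixed points, unfolding -/

namespace CE

theorem psiAux_list (I : Finset ℕ) (S : {i // i ∈ I} → CE L V) (τ : Option (Ctx L V))
    (ρ : ℕ → L.Term V → PosCE L V) (t : L.Term V) :
    (CE.list I S τ).psiAux ρ t = .meet I (fun i => atChild t i.1 ((S i).psiAux ρ)) τ := rfl

theorem psiAux_choice (S S' : CE L V) (ρ : ℕ → L.Term V → PosCE L V) (t : L.Term V) :
    (CE.choice S S').psiAux ρ t = (S.psiAux ρ t).orElse (S'.psiAux ρ t) := rfl

theorem psiAux_cond (S S' : CE L V) (ρ : ℕ → L.Term V → PosCE L V) (t : L.Term V) :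
    (CE.cond S S').psiAux ρ t = (S.psiAux ρ t).andThen (S'.psiAux ρ t) := rfl

theorem psiAux_most (S : CE L V) (ρ : ℕ → L.Term V → PosCE L V) (t : L.Term V) :
    (CE.most S).psiAux ρ t =
      .meet (Finset.Icc 1 (arity t)) (fun i => atChild t i.1 (S.psiAux ρ)) none := rfl

/-- The successive approximations of a fixed point. -/
noncomputable def approx (X : ℕ) (S : CE L V) (ρ : ℕ → L.Term V → PosCE L V) :
    ℕ → L.Term V → PosCE L V
  | 0 => fun _ => .fail
  | n + 1 => S.psiAux (Function.update ρ X (approx X S ρ n))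

theorem psiAux_mu (X : ℕ) (S : CE L V) (ρ : ℕ → L.Term V → PosCE L V) (t : L.Term V) :
    (CE.mu X S).psiAux ρ t = approx X S ρ (depth t) t := by
  have key : ∀ n : ℕ, ((fun g : L.Term V → PosCE L V => S.psiAux (Function.update ρ X g))^[n]
      fun _ => .fail) = approx X S ρ n := by
    intro n
    induction n with
    | zero => rfl
    | succ n ih => rw [Function.iterate_succ_apply', ih, approx]
  simp only [psiAux, key]

/-- The value of `S` at `t` depends on the value of a variable at terms of the depth of `t` only if
the variable is not guarded in `S`, and never on its values at deeper terms. -/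
theorem psiAux_local (S : CE L V) : ∀ (n : ℕ) (ρ ρ' : ℕ → L.Term V → PosCE L V),
    (∀ X t, depth t < n → ρ X t = ρ' X t) →
    (∀ X, ¬ S.Guarded X → ∀ t, depth t ≤ n → ρ X t = ρ' X t) →
    ∀ t, depth t ≤ n → S.psiAux ρ t = S.psiAux ρ' t := by
  induction S with
  | fail => intros; rfl
  | var X => intro n ρ ρ' _ h t ht; exact h X (fun h => h rfl) t ht
  | list I S τ ih =>
    intro n ρ ρ' h _ t ht
    simp only [psiAux_list]
    congr 1
    funext i
    exact atChild_congr fun t' ht' => ih i (depth t') ρ ρ' (fun X s hs => h X s (by omega))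
      (fun X _ s hs => h X s (by omega)) t' le_rfl
  | guard u S ih =>
    intro n ρ ρ' h h' t ht
    simp only [psiAux, ih n ρ ρ' h h' t ht]
  | choice S S' ih ih' =>
    intro n ρ ρ' h h' t ht
    simp only [psiAux_choice, ih n ρ ρ' h (fun X hX => h' X fun hg => hX hg.1) t ht,
      ih' n ρ ρ' h (fun X hX => h' X fun hg => hX hg.2) t ht]
  | mu Y S ih =>
    intro n ρ ρ' h h' t ht
    have key : ∀ k t, depth t ≤ n → approx Y S ρ k t = approx Y S ρ' k t := by
      intro k
      induction k with
      | zero => intros; rfl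
      | succ k ihk =>
        refine ih n _ _ ?_ ?_
        · intro X s hs
          by_cases hX : X = Y
          · subst hX; simpa using ihk s hs.le
          · simpa [hX] using h X s hs
        · intro X hg s hs
          by_cases hX : X = Y
          · subst hX; simpa using ihk s hs
          · simpa [hX] using h' X (fun hm => hm.elim (fun e => hX e.symm) hg) s hs
    rw [psiAux_mu, psiAux_mu, key _ t ht]
  | most S ih =>
    intro n ρ ρ' h _ t ht
    simp only [psiAux_most]
    congr 1
    funext i
    exact atChild_congr fun t' ht' => ih (depth t') ρ ρ' (fun X s hs => h X s (by omega))
      (fun X _ s hs => h X s (by omega)) t' le_rfl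
  | cond S S' ih ih' =>
    intro n ρ ρ' h h' t ht
    simp only [psiAux_cond, ih n ρ ρ' h (fun X hX => h' X fun hg => hX hg.1) t ht,
      ih' n ρ ρ' h (fun X hX => h' X fun hg => hX hg.2) t ht]

/-- By locality, a guarded body at depth at most `k + 1` consults `X` only at depth at most `k`,
where the induction hypothesis says that the two stages agree. The induction can start at `0`
because every depth is positive. -/
theorem approx_succ_eq {X : ℕ} {S : CE L V} (hS : S.Guarded X) (ρ : ℕ → L.Term V → PosCE L V)
    (k : ℕ) : ∀ t, depth t ≤ k → approx X S ρ (k + 1) t = approx X S ρ k t := by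
  induction k with
  | zero => intro t ht; exact absurd (depth_pos t) (by omega)
  | succ k ih =>
    refine psiAux_local S (k + 1) _ _ ?_ ?_
    · intro Y s hs
      by_cases hY : Y = X
      · subst hY; simpa using ih s (by omega)
      · simp [hY]
    · intro Y hg s _
      have hY : Y ≠ X := fun e => hg (e ▸ hS)
      simp [hY]

theorem approx_eq {X : ℕ} {S : CE L V} (hS : S.Guarded X) (ρ : ℕ → L.Term V → PosCE L V)
    {t : L.Term V} {k : ℕ} (hk : depth t ≤ k) : approx X S ρ k t = (CE.mu X S).psiAux ρ t := by
  rw [psiAux_mu]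
  induction k, hk using Nat.le_induction with
  | base => rfl
  | succ k hk ih => rw [approx_succ_eq hS ρ k t hk, ih]

theorem psiAux_of_closed {S : CE L V} (hS : S.Closed) (ρ : ℕ → L.Term V → PosCE L V)
    (t : L.Term V) : S.psiAux ρ t = psi t S :=
  congrFun (psiAux_congr S ρ _ fun X hX => (hS X hX).elim) t

/-- The equality that justifies replacing a fixed point by its unfolding in a tuple; it needs
monotonicity, because the number of iterations is fixed by the depth. -/
theorem psi_unfold {X : ℕ} {S : CE L V} (hc : (CE.mu X S).Closed) (hS : S.Guarded X)
    (t : L.Term V) : psi t (S.subst X (.mu X S)) = psi t (.mu X S) := by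
  unfold psi
  -- The right-hand side is read at stage `depth t + 1`, one more than its definition uses. Both
  -- sides then evaluate the body `S`, with `X` standing for the fixed point on the left and for
  -- stage `depth t` on the right; these agree up to depth `depth t`.
  rw [psiAux_subst X _ hc, ← approx_eq hS _ (Nat.le_succ (depth t))]
  refine psiAux_local S (depth t) _ _ ?_ ?_ t le_rfl <;>
  · intro Y
    by_cases hY : Y = X
    · subst hY
      intros
      simp only [Function.update_self]
      exact (approx_eq hS _ (by omega)).symm
    · simp [hY]

theorem guarded_of_not_freeIn {X : ℕ} {S : CE L V} (h : ¬ S.FreeIn X) : S.Guarded X := by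
  induction S with
  | fail | list | most => trivial
  | var Y => exact h
  | guard u S ih => exact ih h
  | choice S S' ih ih' => exact ⟨ih fun hf => h (.inl hf), ih' fun hf => h (.inr hf)⟩
  | mu Y S ih =>
    by_cases hY : Y = X
    · exact .inl hY
    · exact .inr (ih fun hf => h ⟨hY, hf⟩)
  | cond S S' ih ih' => exact ⟨ih fun hf => h (.inl hf), ih' fun hf => h (.inr hf)⟩

theorem Guarded.subst {X Y : ℕ} {R : CE L V} (hR : R.Closed) {S : CE L V} (h : S.Guarded Y) :
    (S.subst X R).Guarded Y := by
  induction S with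
  | fail | list | most => trivial
  | var Z =>
    simp only [CE.subst]
    split_ifs
    · exact guarded_of_not_freeIn (hR Y)
    · exact h
  | guard u S ih => exact ih h
  | choice S S' ih ih' => exact ⟨ih h.1, ih' h.2⟩
  | mu Z S ih =>
    simp only [CE.subst]
    split_ifs
    · exact h
    · exact h.imp_right ih
  | cond S S' ih ih' => exact ⟨ih h.1, ih' h.2⟩

theorem Monotonic.subst {X : ℕ} {R : CE L V} (hc : R.Closed) (hR : R.Monotonic) {S : CE L V}
    (h : S.Monotonic) : (S.subst X R).Monotonic := by
  induction S with
  | fail => trivial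
  | var Z =>
    simp only [CE.subst]
    split_ifs
    · exact hR
    · exact h
  | list I S τ ih => exact fun i => ih i (h i)
  | guard u S ih => exact ih h
  | choice S S' ih ih' => exact ⟨ih h.1, ih' h.2⟩
  | mu Z S ih =>
    simp only [CE.subst]
    split_ifs
    · exact h
    · exact ⟨h.1.subst hc, ih h.2⟩
  | most S ih => exact ih h
  | cond S S' ih ih' => exact ⟨ih h.1, ih' h.2⟩

/-- The strategies that replace a component of a tuple when a rule is applied to it. -/
inductive Succ : CE L V → CE L V → Prop
  | list (I) (S : {i // i ∈ I} → CE L V) (τ i) : Succ (.list I S τ) (S i)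
  | guard (u S) : Succ (.guard u S) S
  | choice_left (S S') : Succ (.choice S S') S
  | choice_right (S S') : Succ (.choice S S') S'
  | mu (X S) : Succ (.mu X S) (S.subst X (.mu X S))
  | most (S) : Succ (.most S) S
  | most_list (S) : Succ (.most S) (.list (Finset.Icc 1 (maxArity L)) (fun _ => S) none)
  | cond (S S') : Succ (.cond S S') S'

theorem Succ.closed {S S' : CE L V} (h : Succ S S') (hS : S.Closed) : S'.Closed := by
  cases h with
  | list I S τ i => exact fun X hX => hS X ⟨i, hX⟩
  | guard | most => exact hS
  | choice_left => exact fun X hX => hS X (.inl hX)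
  | choice_right => exact fun X hX => hS X (.inr hX)
  | mu X S =>
    exact fun Y hY => hS Y ⟨(FreeIn_subst hS S hY).1.symm, (FreeIn_subst hS S hY).2⟩
  | most_list S => exact fun X ⟨_, hX⟩ => hS X hX
  | cond => exact fun X hX => hS X (.inr hX)

theorem Succ.monotonic {S S' : CE L V} (h : Succ S S') (hc : S.Closed) (hS : S.Monotonic) :
    S'.Monotonic := by
  cases h with
  | list I S τ i => exact hS i
  | guard | most => exact hS
  | choice_left => exact hS.1
  | choice_right => exact hS.2
  | mu X S => exact Monotonic.subst hc hS hS.2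
  | most_list S => exact fun _ => hS
  | cond => exact hS.2

/-- The number of fixed points that can be unfolded before a jump or a `Most` is met. -/
def unfoldings : CE L V → ℕ
  | .fail => 0
  | .var _ => 0
  | .list _ _ _ => 0
  | .guard _ S => S.unfoldings
  | .choice S S' => S.unfoldings + S'.unfoldings
  | .mu _ S => S.unfoldings + 1
  | .most _ => 0
  | .cond _ S => S.unfoldings

/-- Copies of `R` are inserted only below jumps and `Most`, which the count does not enter, or in
conditions, which it ignores. Hence unfolding a monotonic fixed point lowers the count by exactly
one. -/
theorem unfoldings_subst {X : ℕ} {R S : CE L V} (h : S.Guarded X) :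
    (S.subst X R).unfoldings = S.unfoldings := by
  induction S with
  | fail | list | most => rfl
  | var Y => simp [subst, show Y ≠ X from h]
  | guard u S ih => exact ih h
  | choice S S' ih ih' => simp only [subst, unfoldings, ih h.1, ih' h.2]
  | mu Y S ih =>
    by_cases hY : Y = X
    · simp [subst, hY]
    · simp only [subst, hY, if_false, unfoldings, ih (h.resolve_left hY)]
  | cond S S' ih ih' => simp only [subst, unfoldings, ih' h.2]

/-- Jumps beyond the arity of `t` fail and disappear, while boundedness of the arities ensures that
no actual child is missed. -/
theorem psi_most_equiv (hL : BddAbove {n | Nonempty (L.Functions n)}) (t : L.Term V)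
    (S : CE L V) :
    psi t (.list (Finset.Icc 1 (maxArity L)) (fun _ => S) none) ≈ psi t (.most S) := by
  rw [PosCE.equiv_iff_get]
  unfold psi
  rw [psiAux_list, psiAux_most]
  rintro (_ | ⟨i, p⟩)
  · simp
  · simp only [PosCE.get_meet_cons]
    by_cases h : i ∈ Finset.Icc 1 (arity t)
    · have h' : i ∈ Finset.Icc 1 (maxArity L) := by
        have := arity_le_maxArity hL t
        simp only [Finset.mem_Icc] at h ⊢
        omega
      simp [h, h']
    · simp [h, atChild, child_of_notMem h]

end CE

/-! ### Big-step unification and its soundness -/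

open CE

/-- Big-step form of the unification system: `Unifies S S' M T` if the reduction rules,
priorities being disregarded, turn the tuple `⟨S, S', M⟩` into the strategy `T`. -/
inductive Unifies : CE L V → CE L V → Memory L V → CE L V → Prop
  | fail_left (S M) : Unifies .fail S M .fail
  | fail_right (S M) : Unifies S .fail M .fail
  | ins_ins (τ τ' M) : Unifies (.ins τ) (.ins τ') M (.ins (τ.comp τ'))
  | guard_left {S S' M T} (u) (h : Unifies S S' M T) : Unifies (.guard u S) S' M (.guard u T)
  | guard_right {S S' M T} (u) (h : Unifies S' S M T) : Unifies S' (.guard u S) M (.guard u T)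
  | jump_jump {S S' M} (i) (T : {j // j ∈ ({i} : Finset ℕ)} → CE L V)
      (h : ∀ j, Unifies S S' M (T j)) : Unifies (.jump i S) (.jump i S') M (.list {i} T none)
  | list_list {I J M} {S : {i // i ∈ I} → CE L V} {S' : {j // j ∈ J} → CE L V} (τ τ')
      (T : ∀ i, i ∈ I → i ∈ J → CE L V)
      (h : ∀ i hI hJ, Unifies (S ⟨i, hI⟩) (S' ⟨i, hJ⟩) M (T i hI hJ)) :
      Unifies (.list I S τ) (.list J S' τ') M
        (.cond (.list I S τ) (.cond (.list J S' τ')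
          (.list (I ∪ J)
            (fun i =>
              if hI : i.1 ∈ I then
                if hJ : i.1 ∈ J then
                  .choice (T i.1 hI hJ) (.choice (S ⟨i, hI⟩) (S' ⟨i, hJ⟩))
                else S ⟨i, hI⟩
              else S' ⟨i, (Finset.mem_union.1 i.2).resolve_left hI⟩)
            (mergeOpt τ τ'))))
  | choice_left {S₁ S₂ S M T₁ T₂} (h₁ : Unifies S₁ S M T₁) (h₂ : Unifies S₂ S M T₂) :
      Unifies (.choice S₁ S₂) S M (.choice T₁ T₂)
  | choice_right {S₁ S₂ S M T₁ T₂} (h₁ : Unifies S S₁ M T₁) (h₂ : Unifies S S₂ M T₂) :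
      Unifies S (.choice S₁ S₂) M (.choice T₁ T₂)
  | cond_left {S₂ S M T} (S₁) (h : Unifies S₂ S M T) : Unifies (.cond S₁ S₂) S M (.cond S₁ T)
  | cond_right {S₂ S M T} (S₁) (h : Unifies S S₂ M T) : Unifies S (.cond S₁ S₂) M (.cond S₁ T)
  | most_most {S S' M T} (h : Unifies S S' M T) :
      Unifies (.most S) (.most S') M
        (.cond (.most S) (.cond (.most S') (.most (.choice T (.choice S S')))))
  | most_list {S I S' τ M T}
      (h : Unifies (.list (Finset.Icc 1 (maxArity L)) (fun _ => S) none) (.list I S' τ) M T) :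
      Unifies (.most S) (.list I S' τ) M T
  | list_most {S I S' τ M T}
      (h : Unifies (.list I S' τ) (.list (Finset.Icc 1 (maxArity L)) (fun _ => S) none) M T) :
      Unifies (.list I S' τ) (.most S) M T
  | mu_left_unfold {X S S' M Z T} (hZ : Fresh Z (.mu X S) S' M)
      (h : Unifies (S.subst X (.mu X S)) S' (M ∪ {(.mu X S, S', Z)}) T) :
      Unifies (.mu X S) S' M (.mu Z T)
  | mu_right_unfold {X S S' M Z T} (hZ : Fresh Z S' (.mu X S) M)
      (h : Unifies S' (S.subst X (.mu X S)) (M ∪ {(S', .mu X S, Z)}) T) :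
      Unifies S' (.mu X S) M (.mu Z T)
  | memory {S S' M Z} (hM : (S, S', Z) ∈ M) : Unifies S S' M (.var Z)

/-- The free variables of the result come from the memory. -/
theorem Unifies.freeIn {S S' T : CE L V} {M : Memory L V} (h : Unifies S S' M T) :
    S.Closed → S'.Closed → ∀ Y, T.FreeIn Y → ∃ A B, (A, B, Y) ∈ M := by
  induction h with
  | fail_left | fail_right => exact fun _ _ Y hY => hY.elim
  | ins_ins => exact fun _ _ Y ⟨i, _⟩ => (Finset.notMem_empty _ i.2).elim
  | guard_left u h ih => exact fun hS hS' => ih hS hS'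
  | guard_right u h ih => exact fun hS hS' => ih hS hS'
  | jump_jump i T h ih =>
    intro hS hS' Y ⟨j, hj⟩
    exact ih j (fun X hX => hS X ⟨⟨i, Finset.mem_singleton_self i⟩, hX⟩)
      (fun X hX => hS' X ⟨⟨i, Finset.mem_singleton_self i⟩, hX⟩) Y hj
  | list_list τ τ' T h ih =>
    rintro hS hS' Y (hY | hY | ⟨i, hi⟩)
    · exact (hS Y hY).elim
    · exact (hS' Y hY).elim
    · dsimp only at hi
      split_ifs at hi with hI hJ
      · rcases hi with hi | hi | hi
        · exact ih _ hI hJ (fun X hX => hS X ⟨_, hX⟩) (fun X hX => hS' X ⟨_, hX⟩) Y hi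
        · exact (hS Y ⟨_, hi⟩).elim
        · exact (hS' Y ⟨_, hi⟩).elim
      · exact (hS Y ⟨_, hi⟩).elim
      · exact (hS' Y ⟨_, hi⟩).elim
  | choice_left _ _ ih₁ ih₂ =>
    rintro hS hS' Y (hY | hY)
    · exact ih₁ (fun X hX => hS X (.inl hX)) hS' Y hY
    · exact ih₂ (fun X hX => hS X (.inr hX)) hS' Y hY
  | choice_right _ _ ih₁ ih₂ =>
    rintro hS hS' Y (hY | hY)
    · exact ih₁ hS (fun X hX => hS' X (.inl hX)) Y hY
    · exact ih₂ hS (fun X hX => hS' X (.inr hX)) Y hY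
  | cond_left S₁ _ ih =>
    rintro hS hS' Y (hY | hY)
    · exact (hS Y (.inl hY)).elim
    · exact ih (fun X hX => hS X (.inr hX)) hS' Y hY
  | cond_right S₁ _ ih =>
    rintro hS hS' Y (hY | hY)
    · exact (hS' Y (.inl hY)).elim
    · exact ih hS (fun X hX => hS' X (.inr hX)) Y hY
  | most_most _ ih =>
    rintro hS hS' Y (hY | hY | hY | hY | hY)
    · exact (hS Y hY).elim
    · exact (hS' Y hY).elim
    · exact ih hS hS' Y hY
    · exact (hS Y hY).elim
    · exact (hS' Y hY).elim
  | most_list _ ih => exact fun hS hS' => ih ((Succ.most_list _).closed hS) hS'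
  | list_most _ ih => exact fun hS hS' => ih hS ((Succ.most_list _).closed hS')
  | mu_left_unfold _ _ ih =>
    rintro hS hS' Y ⟨hZ, hY⟩
    obtain ⟨A, B, hM | hM⟩ := ih ((Succ.mu _ _).closed hS) hS' Y hY
    · exact ⟨A, B, hM⟩
    · simp only [Set.mem_singleton_iff, Prod.mk.injEq] at hM
      exact (hZ hM.2.2.symm).elim
  | mu_right_unfold _ _ ih =>
    rintro hS hS' Y ⟨hZ, hY⟩
    obtain ⟨A, B, hM | hM⟩ := ih hS ((Succ.mu _ _).closed hS') Y hY
    · exact ⟨A, B, hM⟩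
    · simp only [Set.mem_singleton_iff, Prod.mk.injEq] at hM
      exact (hZ hM.2.2.symm).elim
  | memory hM =>
    rintro _ _ Y rfl
    exact ⟨_, _, hM⟩

/-- The variables of the memory stand for the unifications they abbreviate, at all terms of depth
smaller than `n`, and at terms of depth `n` for the pairs with at most `h` unfoldings. -/
def Memory.Sound (M : Memory L V) (ρ : ℕ → L.Term V → PosCE L V) (n h : ℕ) : Prop :=
  ∀ A B Y, (A, B, Y) ∈ M → ∀ t, (depth t < n ∨ depth t = n ∧ A.unfoldings + B.unfoldings ≤ h) →
    ρ Y t ≈ (psi t A).unify (psi t B)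

theorem Memory.Sound.mono {M : Memory L V} {ρ : ℕ → L.Term V → PosCE L V} {n h n' h' : ℕ}
    (hM : M.Sound ρ n h) (hn : n' < n ∨ n' = n ∧ h' ≤ h) : M.Sound ρ n' h' :=
  fun A B Y hY t ht => hM A B Y hY t (by omega)

/-- A fixed point over a fresh variable computes the unification that the variable abbreviates,
if its body does so one level further on. -/
theorem psiAux_mu_equiv_unify {S S' U U' T : CE L V} {M : Memory L V} {Z : ℕ}
    (hfresh : ∀ A B Y, (A, B, Y) ∈ M → Y ≠ Z)
    (hU : ∀ t, (psi t U).unify (psi t U') = (psi t S).unify (psi t S'))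
    (hlt : U.unfoldings + U'.unfoldings < S.unfoldings + S'.unfoldings)
    (ih : ∀ ρ t, (M ∪ {(S, S', Z)} : Memory L V).Sound ρ (depth t)
      (U.unfoldings + U'.unfoldings) → T.psiAux ρ t ≈ (psi t U).unify (psi t U'))
    (ρ : ℕ → L.Term V → PosCE L V) (t : L.Term V)
    (hM : M.Sound ρ (depth t) (S.unfoldings + S'.unfoldings)) :
    (CE.mu Z T).psiAux ρ t ≈ (psi t S).unify (psi t S') := by
  rw [psiAux_mu]
  -- Induction on the approximation stage, for all terms no deeper than `t` at once: the value of
  -- `Z` at stage `k + 1` is needed at shallower terms, where stage `k` is already correct.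
  have key : ∀ k s, depth s ≤ k → depth s ≤ depth t →
      approx Z T ρ k s ≈ (psi s S).unify (psi s S') := by
    intro k
    induction k with
    | zero => intro s hs; exact absurd (depth_pos s) (by omega)
    | succ k ihk =>
      intro s hs hst
      rw [← hU]
      refine ih _ s ?_
      rintro A B Y (hY | hY) r hr
      · rw [Function.update_of_ne (hfresh A B Y hY)]
        exact hM A B Y hY r (by omega)
      -- For the newly recorded pair, the equal-depth alternative in `hr` contradicts `hlt`; only
      -- strictly smaller depths remain.
      · simp only [Set.mem_singleton_iff, Prod.mk.injEq] at hY
        obtain ⟨rfl, rfl, rfl⟩ := hY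
        rw [Function.update_self]
        exact ihk r (by omega) (by omega)
  exact key _ t le_rfl le_rfl

/-- Induction on the derivation. The memory hypothesis passes to premises because each either moves
to a smaller term or keeps the term without raising the total number of unfoldings. It is applied to
a recorded pair with exactly that pair's own count. -/
theorem Unifies.sound (hL : BddAbove {n | Nonempty (L.Functions n)}) {S S' T : CE L V}
    {M : Memory L V} (h : Unifies S S' M T) :
    S.Closed → S.Monotonic → S'.Closed → S'.Monotonic →
    ∀ (ρ : ℕ → L.Term V → PosCE L V) (t : L.Term V),
      M.Sound ρ (depth t) (S.unfoldings + S'.unfoldings) →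
      T.psiAux ρ t ≈ (psi t S).unify (psi t S') := by
  induction h with
  | fail_left => exact fun _ _ _ _ _ _ _ => PosCE.fail_equiv_unify (.inl rfl)
  | fail_right => exact fun _ _ _ _ _ _ _ => PosCE.fail_equiv_unify (.inr rfl)
  | ins_ins => exact fun _ _ _ _ _ _ _ => PosCE.meet_empty_unify _ _ _ _ _
  | guard_left u h ih =>
    intro hS hm hS' hm' ρ t hM
    rw [psi_guard, psiAux]
    split_ifs
    · exact ih hS hm hS' hm' ρ t hM
    · exact PosCE.fail_equiv_unify (.inl rfl)
  | guard_right u h ih =>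
    intro hS hm hS' hm' ρ t hM
    rw [psi_guard, psiAux]
    split_ifs
    · exact ih hS hm hS' hm' ρ t hM
    · exact PosCE.fail_equiv_unify (.inr rfl)
  | @jump_jump S S' M i T h ih =>
    intro hS hm hS' hm' ρ t hM
    refine Setoid.trans ?_ (PosCE.meet_singleton_unify i (fun j => atChild t j.1 fun t' => psi t' S)
      (fun j => atChild t j.1 fun t' => psi t' S'))
    refine PosCE.meet_congr fun j => Setoid.trans (atChild_equiv fun t' ht' => ?_)
      (atChild_unify t j.1 _ _)
    exact ih j (fun X hX => hS X ⟨⟨i, Finset.mem_singleton_self i⟩, hX⟩)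
      (hm ⟨i, Finset.mem_singleton_self i⟩)
      (fun X hX => hS' X ⟨⟨i, Finset.mem_singleton_self i⟩, hX⟩)
      (hm' ⟨i, Finset.mem_singleton_self i⟩) ρ t' (hM.mono (.inl ht'))
  | @list_list I J M S S' τ τ' T h ih =>
    intro hS hm hS' hm' ρ t hM
    rw [psiAux_cond, psiAux_cond, psiAux_of_closed hS, psiAux_of_closed hS']
    -- The two conditions take care of failure of the whole lists, leaving a pointwise comparison
    -- with merging. At a common index, the fallback choices keep the surviving component when only
    -- one of the two succeeds.
    refine PosCE.andThen_andThen_equiv_unify ?_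
    unfold psi
    simp only [psiAux_list]
    rintro (_ | ⟨i, p⟩)
    · simp
    simp only [PosCE.get_meet_cons, Finset.mem_union]
    have hc : ∀ i, (S i).Closed := fun i X hX => hS X ⟨i, hX⟩
    have hc' : ∀ i, (S' i).Closed := fun i X hX => hS' X ⟨i, hX⟩
    have hr : ∀ i, (S i).psiAux ρ = fun t => psi t (S i) :=
      fun i => funext (psiAux_of_closed (hc i) ρ)
    have hr' : ∀ i, (S' i).psiAux ρ = fun t => psi t (S' i) :=
      fun i => funext (psiAux_of_closed (hc' i) ρ)
    by_cases hI : i ∈ I <;> by_cases hJ : i ∈ J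
    · simp only [hI, hJ, true_or, dif_pos]
      refine Eq.trans ?_ (PosCE.get_unify_orElse _ _ p)
      refine PosCE.equiv_iff_get.1 ?_ p
      have : CE.psiAux (.choice (T i hI hJ) (.choice (S ⟨i, hI⟩) (S' ⟨i, hJ⟩))) ρ =
          fun t' => ((T i hI hJ).psiAux ρ t').orElse
            ((psi t' (S ⟨i, hI⟩)).orElse (psi t' (S' ⟨i, hJ⟩))) := by
        funext t'
        rw [psiAux_choice, psiAux_choice, hr, hr']
      rw [this, atChild_orElse, atChild_orElse]
      refine PosCE.orElse_congr ?_ (Setoid.refl _)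
      refine Setoid.trans (atChild_equiv fun t' ht' => ?_) (atChild_unify t i _ _)
      exact ih i hI hJ (hc _) (hm _) (hc' _) (hm' _) ρ t' (hM.mono (.inl ht'))
    · simp only [hI, hJ, true_or, dif_pos, dif_neg, not_false_eq_true, hr]
      change _ = mergeOpt ((atChild t i fun t' => psi t' (S ⟨i, hI⟩)).get p) none
      cases (atChild t i fun t' => psi t' (S ⟨i, hI⟩)).get p <;> rfl
    · simp only [hI, hJ, or_true, dif_pos, dif_neg, not_false_eq_true, hr']
      rfl
    · simp [hI, hJ, mergeOpt]
  | choice_left _ _ ih₁ ih₂ =>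
    intro hS hm hS' hm' ρ t hM
    rw [psiAux_choice]
    refine Setoid.trans (PosCE.orElse_congr
      (ih₁ (fun X hX => hS X (.inl hX)) hm.1 hS' hm' ρ t (hM.mono (.inr ⟨rfl, ?_⟩)))
      (ih₂ (fun X hX => hS X (.inr hX)) hm.2 hS' hm' ρ t (hM.mono (.inr ⟨rfl, ?_⟩))))
      (PosCE.orElse_unify _ _ _) <;>
    · simp only [unfoldings]
      omega
  | choice_right _ _ ih₁ ih₂ =>
    intro hS hm hS' hm' ρ t hM
    rw [psiAux_choice]
    refine Setoid.trans (PosCE.orElse_congr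
      (ih₁ hS hm (fun X hX => hS' X (.inl hX)) hm'.1 ρ t (hM.mono (.inr ⟨rfl, ?_⟩)))
      (ih₂ hS hm (fun X hX => hS' X (.inr hX)) hm'.2 ρ t (hM.mono (.inr ⟨rfl, ?_⟩))))
      (PosCE.unify_orElse _ _ _) <;>
    · simp only [unfoldings]
      omega
  | cond_left S₁ _ ih =>
    intro hS hm hS' hm' ρ t hM
    rw [psiAux_cond, psiAux_of_closed fun X hX => hS X (.inl hX)]
    exact Setoid.trans (PosCE.andThen_congr_right _
      (ih (fun X hX => hS X (.inr hX)) hm.2 hS' hm' ρ t hM)) (PosCE.andThen_unify _ _ _)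
  | cond_right S₁ _ ih =>
    intro hS hm hS' hm' ρ t hM
    rw [psiAux_cond, psiAux_of_closed fun X hX => hS' X (.inl hX)]
    exact Setoid.trans (PosCE.andThen_congr_right _
      (ih hS hm (fun X hX => hS' X (.inr hX)) hm'.2 ρ t hM)) (PosCE.unify_andThen _ _ _)
  | @most_most S S' M T _ ih =>
    intro hS hm hS' hm' ρ t hM
    rw [psiAux_cond, psiAux_cond, psiAux_of_closed hS, psiAux_of_closed hS']
    refine PosCE.andThen_andThen_equiv_unify ?_
    unfold psi
    simp only [psiAux_most]
    rintro (_ | ⟨i, p⟩)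
    · simp [mergeOpt]
    simp only [PosCE.get_meet_cons]
    split_ifs
    · refine Eq.trans ?_ (PosCE.get_unify_orElse _ _ p)
      refine PosCE.equiv_iff_get.1 ?_ p
      have : CE.psiAux (.choice T (.choice S S')) ρ =
          fun t' => (T.psiAux ρ t').orElse ((psi t' S).orElse (psi t' S')) := by
        funext t'
        rw [psiAux_choice, psiAux_choice, psiAux_of_closed (S := S) hS,
          psiAux_of_closed (S := S') hS']
      rw [this, atChild_orElse, atChild_orElse]
      refine PosCE.orElse_congr ?_ (Setoid.refl _)
      refine Setoid.trans (atChild_equiv fun t' ht' => ?_) (atChild_unify t i _ _)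
      exact ih hS hm hS' hm' ρ t' (hM.mono (.inl ht'))
    · rfl
  | most_list _ ih =>
    intro hS hm hS' hm' ρ t hM
    exact Setoid.trans (ih ((Succ.most_list _).closed hS) (fun _ => hm) hS' hm' ρ t hM)
      (PosCE.unify_congr (psi_most_equiv hL t _) (Setoid.refl _))
  | list_most _ ih =>
    intro hS hm hS' hm' ρ t hM
    exact Setoid.trans (ih hS hm ((Succ.most_list _).closed hS') (fun _ => hm') ρ t hM)
      (PosCE.unify_congr (Setoid.refl _) (psi_most_equiv hL t _))
  | mu_left_unfold hZ _ ih =>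
    intro hS hm hS' hm'
    refine psiAux_mu_equiv_unify (fun A B Y hY => (hZ.2.2 A B Y hY).2.2)
      (fun t => by rw [psi_unfold hS hm.1]) ?_
      (ih ((Succ.mu _ _).closed hS) ((Succ.mu _ _).monotonic hS hm) hS' hm')
    rw [unfoldings_subst hm.1]
    simp only [unfoldings]
    omega
  | mu_right_unfold hZ _ ih =>
    intro hS hm hS' hm'
    refine psiAux_mu_equiv_unify (fun A B Y hY => (hZ.2.2 A B Y hY).2.2)
      (fun t => by rw [psi_unfold hS' hm'.1]) ?_
      (ih hS hm ((Succ.mu _ _).closed hS') ((Succ.mu _ _).monotonic hS' hm'))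
    rw [unfoldings_subst hm'.1]
    simp only [unfoldings]
    omega
  | memory hM =>
    intro _ _ _ _ ρ t h
    exact h _ _ _ hM t (.inr ⟨rfl, le_rfl⟩)

/-! ### From reductions to big-step derivations -/

namespace PreCE

/-- `P.Realizes T`: the strategy `T` is `P` with each tuple replaced by a result of its
unification. -/
def Realizes : PreCE L V → CE L V → Prop
  | .fail, T => T = .fail
  | .var X, T => T = .var X
  | .list I P τ, T => ∃ T' : {i // i ∈ I} → CE L V, T = .list I T' τ ∧ ∀ i, (P i).Realizes (T' i)
  | .guard u P, T => ∃ T', T = .guard u T' ∧ P.Realizes T'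
  | .choice P P', T => ∃ T₁ T₂, T = .choice T₁ T₂ ∧ P.Realizes T₁ ∧ P'.Realizes T₂
  | .mu X P, T => ∃ T', T = .mu X T' ∧ P.Realizes T'
  | .most P, T => ∃ T', T = .most T' ∧ P.Realizes T'
  | .cond S P, T => ∃ T', T = .cond S T' ∧ P.Realizes T'
  | .tuple S S' M, T => Unifies S S' M T

theorem realizes_toPre {S T : CE L V} : S.toPre.Realizes T ↔ T = S := by
  induction S generalizing T with
  | fail => exact Iff.rfl
  | var X => exact Iff.rfl
  | list I S τ ih =>
    constructor
    · rintro ⟨T', rfl, h⟩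
      exact congrArg (CE.list I · τ) (funext fun i => (ih i).1 (h i))
    · rintro rfl
      exact ⟨S, rfl, fun i => (ih i).2 rfl⟩
  | guard u S ih =>
    constructor
    · rintro ⟨T', rfl, h⟩; rw [ih.1 h]
    · rintro rfl; exact ⟨S, rfl, ih.2 rfl⟩
  | choice S S' ih ih' =>
    constructor
    · rintro ⟨T₁, T₂, rfl, h, h'⟩; rw [ih.1 h, ih'.1 h']
    · rintro rfl; exact ⟨S, S', rfl, ih.2 rfl, ih'.2 rfl⟩
  | mu X S ih =>
    constructor
    · rintro ⟨T', rfl, h⟩; rw [ih.1 h]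
    · rintro rfl; exact ⟨S, rfl, ih.2 rfl⟩
  | most S ih =>
    constructor
    · rintro ⟨T', rfl, h⟩; rw [ih.1 h]
    · rintro rfl; exact ⟨S, rfl, ih.2 rfl⟩
  | cond S S' ih ih' =>
    constructor
    · rintro ⟨T', rfl, h⟩; rw [ih'.1 h]
    · rintro rfl; exact ⟨S', rfl, ih'.2 rfl⟩

end PreCE

open PreCE

/-- Each rule is matched by a constructor of `Unifies`, the tuples on its right-hand side being
replaced by their results. -/
theorem Rule.unifies {k : ℕ} {S S' : CE L V} {M : Memory L V} {P : PreCE L V}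
    (h : Rule k S S' M P) {T : CE L V} (hT : P.Realizes T) : Unifies S S' M T := by
  cases h with
  | fail_left => obtain rfl := hT; exact .fail_left _ _
  | fail_right => obtain rfl := hT; exact .fail_right _ _
  | ins_ins => obtain rfl := realizes_toPre.1 hT; exact .ins_ins _ _ _
  | guard_left => obtain ⟨T, rfl, h⟩ := hT; exact .guard_left _ h
  | guard_right => obtain ⟨T, rfl, h⟩ := hT; exact .guard_right _ h
  | jump_jump => obtain ⟨T, rfl, h⟩ := hT; exact .jump_jump _ T h
  | list_list I J S S' τ τ' =>
    obtain ⟨_, rfl, _, rfl, T, rfl, h⟩ := hT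
    -- Only the tuple in a common component leaves any freedom: embedded strategies are realized by
    -- themselves alone. Choosing these results shows that `T` has the shape required by the
    -- constructor.
    have key : ∀ i (hI : i ∈ I) (hJ : i ∈ J), ∃ T',
        T ⟨i, Finset.mem_union_left J hI⟩ = .choice T' (.choice (S ⟨i, hI⟩) (S' ⟨i, hJ⟩)) ∧
        Unifies (S ⟨i, hI⟩) (S' ⟨i, hJ⟩) M T' := by
      intro i hI hJ
      have := h ⟨i, Finset.mem_union_left J hI⟩
      simp only [hI, hJ, dif_pos] at this
      obtain ⟨T', _, e, hu, T₁, T₂, rfl, h₁, h₂⟩ := this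
      rw [realizes_toPre.1 h₁, realizes_toPre.1 h₂] at e
      exact ⟨T', e, hu⟩
    choose T' hT' hu using key
    have hTe : T = fun i : {i // i ∈ I ∪ J} => if hI : i.1 ∈ I then
        if hJ : i.1 ∈ J then .choice (T' i.1 hI hJ) (.choice (S ⟨i, hI⟩) (S' ⟨i, hJ⟩))
        else S ⟨i, hI⟩
      else S' ⟨i, (Finset.mem_union.1 i.2).resolve_left hI⟩ := by
      funext i
      split_ifs with hI hJ
      · exact hT' i hI hJ
      · have := h i
        simp only [hI, hJ, dif_pos, dif_neg, not_false_eq_true] at this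
        exact realizes_toPre.1 this
      · have := h i
        simp only [hI, dif_neg, not_false_eq_true] at this
        exact realizes_toPre.1 this
    rw [hTe]
    exact .list_list τ τ' T' hu
  | choice_left => obtain ⟨T₁, T₂, rfl, h₁, h₂⟩ := hT; exact .choice_left h₁ h₂
  | choice_right => obtain ⟨T₁, T₂, rfl, h₁, h₂⟩ := hT; exact .choice_right h₁ h₂
  | cond_left => obtain ⟨T, rfl, h⟩ := hT; exact .cond_left _ h
  | cond_right => obtain ⟨T, rfl, h⟩ := hT; exact .cond_right _ h
  | most_most =>
    obtain ⟨_, rfl, _, rfl, _, rfl, T, _, rfl, h, T₁, T₂, rfl, h₁, h₂⟩ := hT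
    rw [realizes_toPre.1 h₁, realizes_toPre.1 h₂]
    exact .most_most h
  | most_list => exact .most_list hT
  | list_most => exact .list_most hT
  | mu_left_unfold _ _ _ _ _ _ hZ => obtain ⟨T, rfl, h⟩ := hT; exact .mu_left_unfold hZ h
  | mu_left_memory _ _ _ _ _ hM => obtain rfl := hT; exact .memory hM
  | mu_right_unfold _ _ _ _ _ _ hZ => obtain ⟨T, rfl, h⟩ := hT; exact .mu_right_unfold hZ h
  | mu_right_memory _ _ _ _ _ hM => obtain rfl := hT; exact .memory hM

/-- Results are transported backwards, from the reduct to the redex. Starting from a normal form,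
which realizes itself, this covers every reduction without any appeal to confluence. -/
theorem Step.realizes {P Q : PreCE L V} (h : Step P Q) : ∀ {T}, Q.Realizes T → P.Realizes T := by
  induction h with
  | tuple h _ => exact h.unifies
  | @list I P τ i Q _ ih =>
    rintro T ⟨T', rfl, hT⟩
    refine ⟨T', rfl, fun j => ?_⟩
    have := hT j
    by_cases hj : j = i
    · subst hj
      rw [Function.update_self] at this
      exact ih this
    · rwa [Function.update_of_ne hj] at this
  | guard _ ih => rintro T ⟨T', rfl, hT⟩; exact ⟨T', rfl, ih hT⟩
  | choice_left _ ih => rintro T ⟨T₁, T₂, rfl, h₁, h₂⟩; exact ⟨T₁, T₂, rfl, ih h₁, h₂⟩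
  | choice_right _ ih => rintro T ⟨T₁, T₂, rfl, h₁, h₂⟩; exact ⟨T₁, T₂, rfl, h₁, ih h₂⟩
  | mu _ ih => rintro T ⟨T', rfl, hT⟩; exact ⟨T', rfl, ih hT⟩
  | most _ ih => rintro T ⟨T', rfl, hT⟩; exact ⟨T', rfl, ih hT⟩
  | cond _ ih => rintro T ⟨T', rfl, hT⟩; exact ⟨T', rfl, ih hT⟩

theorem realizes_of_reduces {P Q : PreCE L V} (h : Relation.ReflTransGen Step P Q) {T : CE L V}
    (hT : Q.Realizes T) : P.Realizes T := by
  induction h using Relation.ReflTransGen.head_induction_on with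
  | refl => exact hT
  | head h _ ih => exact h.realizes ih

/-! ### Progress -/

theorem CE.finite_occurs (S : CE L V) : {X | S.Occurs X}.Finite := by
  induction S with
  | fail => exact Set.finite_empty
  | var Y => exact (Set.finite_singleton Y).subset fun X hX => Eq.symm hX
  | list I S τ ih =>
    refine (Set.finite_iUnion ih).subset ?_
    rintro X ⟨i, hi⟩
    exact Set.mem_iUnion.2 ⟨i, hi⟩
  | guard u S ih => exact ih
  | choice S S' ih ih' => exact ih.union ih'
  | mu Y S ih => exact ((Set.finite_singleton Y).union ih).subset fun X hX => hX.imp_left Eq.symm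
  | most S ih => exact ih
  | cond S S' ih ih' => exact ih.union ih'

/-- Memories are arbitrary sets, so finiteness has to be assumed and carried along; an infinite
memory could exhaust the variables and block an unfolding. -/
theorem exists_fresh (S S' : CE L V) {M : Memory L V} (hM : M.Finite) : ∃ Z, Fresh Z S S' M := by
  have hfin : ({X | S.Occurs X} ∪ {X | S'.Occurs X} ∪
      ⋃ m ∈ M, ({X | m.1.Occurs X} ∪ {X | m.2.1.Occurs X} ∪ {m.2.2})).Finite :=
    (S.finite_occurs.union S'.finite_occurs).union <| hM.biUnion fun m _ =>
      (m.1.finite_occurs.union m.2.1.finite_occurs).union (Set.finite_singleton _)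
  obtain ⟨Z, hZ⟩ := hfin.exists_notMem
  simp only [Set.mem_union, Set.mem_iUnion, not_or, not_exists, Set.mem_ofPred_eq,
    Set.mem_singleton_iff] at hZ
  refine ⟨Z, hZ.1.1, hZ.1.2, fun A B Y hY => ?_⟩
  have := hZ.2 _ hY
  exact ⟨this.1.1, this.1.2, fun e => this.2 e.symm⟩

theorem exists_rule_mu_left (X : ℕ) (S S' : CE L V) {M : Memory L V} (hM : M.Finite) :
    ∃ k P, Rule k (.mu X S) S' M P := by
  by_cases h : ∃ Y, (CE.mu X S, S', Y) ∈ M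
  · obtain ⟨Z, hZ⟩ := h
    exact ⟨_, _, .mu_left_memory X S S' M Z hZ⟩
  · obtain ⟨Z, hZ⟩ := exists_fresh (.mu X S) S' hM
    exact ⟨_, _, .mu_left_unfold X S S' M Z (not_exists.1 h) hZ⟩

theorem exists_rule_mu_right (X : ℕ) (S S' : CE L V) {M : Memory L V} (hM : M.Finite) :
    ∃ k P, Rule k S' (.mu X S) M P := by
  by_cases h : ∃ Y, (S', CE.mu X S, Y) ∈ M
  · obtain ⟨Z, hZ⟩ := h
    exact ⟨_, _, .mu_right_memory X S S' M Z hZ⟩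
  · obtain ⟨Z, hZ⟩ := exists_fresh S' (.mu X S) hM
    exact ⟨_, _, .mu_right_unfold X S S' M Z (not_exists.1 h) hZ⟩

/-- The first component alone determines a rule unless it is a list or a `Most`; the second one is
inspected in those cases only. The stuck case of a bare variable is excluded by closedness. -/
theorem exists_rule {S S' : CE L V} (hS : S.Closed) (hS' : S'.Closed) {M : Memory L V}
    (hM : M.Finite) : ∃ k P, Rule k S S' M P := by
  cases S with
  | fail => exact ⟨_, _, .fail_left _ _⟩
  | var X => exact (hS X rfl).elim
  | guard u S => exact ⟨_, _, .guard_left _ _ _ _⟩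
  | choice S₁ S₂ => exact ⟨_, _, .choice_left _ _ _ _⟩
  | mu X S => exact exists_rule_mu_left X S S' hM
  | cond S₁ S₂ => exact ⟨_, _, .cond_left _ _ _ _⟩
  | list I S τ =>
    cases S' with
    | fail => exact ⟨_, _, .fail_right _ _⟩
    | var X => exact (hS' X rfl).elim
    | guard u S => exact ⟨_, _, .guard_right _ _ _ _⟩
    | choice S₁ S₂ => exact ⟨_, _, .choice_right _ _ _ _⟩
    | mu X S => exact exists_rule_mu_right X S _ hM
    | cond S₁ S₂ => exact ⟨_, _, .cond_right _ _ _ _⟩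
    | list J S' τ' => exact ⟨_, _, .list_list _ _ _ _ _ _ _⟩
    | most S' => exact ⟨_, _, .list_most _ _ _ _ _⟩
  | most S =>
    cases S' with
    | fail => exact ⟨_, _, .fail_right _ _⟩
    | var X => exact (hS' X rfl).elim
    | guard u S => exact ⟨_, _, .guard_right _ _ _ _⟩
    | choice S₁ S₂ => exact ⟨_, _, .choice_right _ _ _ _⟩
    | mu X S => exact exists_rule_mu_right X S _ hM
    | cond S₁ S₂ => exact ⟨_, _, .cond_right _ _ _ _⟩
    | list J S' τ' => exact ⟨_, _, .most_list _ _ _ _ _⟩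
    | most S' => exact ⟨_, _, .most_most _ _ _⟩

/-- The rule of highest priority applies. -/
theorem exists_rule_step {S S' : CE L V} (hS : S.Closed) (hS' : S'.Closed) {M : Memory L V}
    (hM : M.Finite) : ∃ k P, Rule k S S' M P ∧ Step (.tuple S S' M) P := by
  classical
  have h := exists_rule hS hS' hM
  -- The least number of an applicable rule is the highest priority.
  obtain ⟨P, hP⟩ := Nat.find_spec h
  exact ⟨_, P, hP, .tuple hP fun j hj Q hQ => Nat.find_min h hj ⟨Q, hQ⟩⟩

namespace PreCE

/-- The tuples inside `P` consist of closed strategies and a finite memory. -/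
def Valid : PreCE L V → Prop
  | .fail => True
  | .var _ => True
  | .list _ P _ => ∀ i, (P i).Valid
  | .guard _ P => P.Valid
  | .choice P P' => P.Valid ∧ P'.Valid
  | .mu _ P => P.Valid
  | .most P => P.Valid
  | .cond _ P => P.Valid
  | .tuple S S' M => S.Closed ∧ S'.Closed ∧ M.Finite

theorem valid_toPre (S : CE L V) : S.toPre.Valid := by
  induction S with
  | fail | var => trivial
  | list I S τ ih => exact ih
  | guard u S ih => exact ih
  | choice S S' ih ih' => exact ⟨ih, ih'⟩
  | mu X S ih => exact ih
  | most S ih => exact ih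
  | cond S S' ih ih' => exact ih'

end PreCE

theorem Rule.valid {k : ℕ} {S S' : CE L V} {M : Memory L V} {P : PreCE L V}
    (h : Rule k S S' M P) (hS : S.Closed) (hS' : S'.Closed) (hM : M.Finite) : P.Valid := by
  cases h with
  | fail_left => trivial
  | fail_right => trivial
  | ins_ins => exact valid_toPre _
  | guard_left => exact ⟨hS, hS', hM⟩
  | guard_right => exact ⟨hS, hS', hM⟩
  | jump_jump i =>
    exact fun j => ⟨(Succ.list _ _ _ ⟨i, Finset.mem_singleton_self i⟩).closed hS,
      (Succ.list _ _ _ ⟨i, Finset.mem_singleton_self i⟩).closed hS', hM⟩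
  | list_list I J S S' τ τ' =>
    intro i
    dsimp only
    split_ifs with hI hJ
    · exact ⟨⟨(Succ.list _ _ _ _).closed hS, (Succ.list _ _ _ _).closed hS', hM⟩,
        valid_toPre _, valid_toPre _⟩
    · exact valid_toPre _
    · exact valid_toPre _
  | choice_left =>
    exact ⟨⟨(Succ.choice_left _ _).closed hS, hS', hM⟩, (Succ.choice_right _ _).closed hS, hS', hM⟩
  | choice_right =>
    exact ⟨⟨hS, (Succ.choice_left _ _).closed hS', hM⟩, hS, (Succ.choice_right _ _).closed hS', hM⟩
  | cond_left => exact ⟨(Succ.cond _ _).closed hS, hS', hM⟩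
  | cond_right => exact ⟨hS, (Succ.cond _ _).closed hS', hM⟩
  | most_most => exact ⟨⟨hS, hS', hM⟩, valid_toPre _, valid_toPre _⟩
  | most_list => exact ⟨(Succ.most_list _).closed hS, hS', hM⟩
  | list_most => exact ⟨hS, (Succ.most_list _).closed hS', hM⟩
  | mu_left_unfold =>
    exact ⟨(Succ.mu _ _).closed hS, hS', hM.union (Set.finite_singleton _)⟩
  | mu_left_memory => trivial
  | mu_right_unfold =>
    exact ⟨hS, (Succ.mu _ _).closed hS', hM.union (Set.finite_singleton _)⟩
  | mu_right_memory => trivial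

theorem Step.valid {P Q : PreCE L V} (h : Step P Q) : P.Valid → Q.Valid := by
  induction h with
  | tuple h _ => exact fun ⟨hS, hS', hM⟩ => h.valid hS hS' hM
  | list i _ ih =>
    intro hP j
    by_cases hj : j = i
    · subst hj
      rw [Function.update_self]
      exact ih (hP j)
    · rw [Function.update_of_ne hj]
      exact hP j
  | guard _ ih => exact ih
  | choice_left _ ih => exact fun hP => ⟨ih hP.1, hP.2⟩
  | choice_right _ ih => exact fun hP => ⟨hP.1, ih hP.2⟩
  | mu _ ih => exact ih
  | most _ ih => exact ih
  | cond _ ih => exact ih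

/-- A pre-strategy in normal form is a strategy. -/
theorem exists_eq_toPre {P : PreCE L V} (hP : P.Valid) (hn : ∀ Q, ¬ Step P Q) :
    ∃ T : CE L V, P = T.toPre := by
  induction P with
  | fail => exact ⟨.fail, rfl⟩
  | var X => exact ⟨.var X, rfl⟩
  | list I P τ ih =>
    choose T hT using fun i => ih i (hP i) fun Q hQ => hn _ (.list i hQ)
    exact ⟨.list I T τ, congrArg (PreCE.list I · τ) (funext hT)⟩
  | guard u P ih =>
    obtain ⟨T, rfl⟩ := ih hP fun Q hQ => hn _ (.guard hQ)
    exact ⟨.guard u T, rfl⟩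
  | choice P P' ih ih' =>
    obtain ⟨T, rfl⟩ := ih hP.1 fun Q hQ => hn _ (.choice_left hQ)
    obtain ⟨T', rfl⟩ := ih' hP.2 fun Q hQ => hn _ (.choice_right hQ)
    exact ⟨.choice T T', rfl⟩
  | mu X P ih =>
    obtain ⟨T, rfl⟩ := ih hP fun Q hQ => hn _ (.mu hQ)
    exact ⟨.mu X T, rfl⟩
  | most P ih =>
    obtain ⟨T, rfl⟩ := ih hP fun Q hQ => hn _ (.most hQ)
    exact ⟨.most T, rfl⟩
  | cond S P ih =>
    obtain ⟨T, rfl⟩ := ih hP fun Q hQ => hn _ (.cond hQ)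
    exact ⟨.cond S T, rfl⟩
  | tuple S S' M =>
    obtain ⟨k, Q, _, hQ⟩ := exists_rule_step hP.1 hP.2.1 hP.2.2
    exact (hn Q hQ).elim

theorem not_step_toPre (T : CE L V) : ∀ Q, ¬ Step T.toPre Q := by
  induction T with
  | fail | var => rintro _ ⟨⟩
  | list I S τ ih =>
    intro Q h
    generalize hP : (CE.list I S τ).toPre = P at h
    cases h <;> cases hP
    exact ih _ _ ‹_›
  | guard u S ih =>
    intro Q h
    generalize hP : (CE.guard u S).toPre = P at h
    cases h <;> cases hP
    exact ih _ ‹_›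
  | choice S S' ih ih' =>
    intro Q h
    generalize hP : (CE.choice S S').toPre = P at h
    cases h <;> cases hP
    · exact ih _ ‹_›
    · exact ih' _ ‹_›
  | mu X S ih =>
    intro Q h
    generalize hP : (CE.mu X S).toPre = P at h
    cases h <;> cases hP
    exact ih _ ‹_›
  | most S ih =>
    intro Q h
    generalize hP : (CE.most S).toPre = P at h
    cases h <;> cases hP
    exact ih _ ‹_›
  | cond S S' ih ih' =>
    intro Q h
    generalize hP : (CE.cond S S').toPre = P at h
    cases h <;> cases hP
    exact ih' _ ‹_›

namespace CE

/-! ### The closure of a strategy -/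

/-- Simultaneous substitution of closed strategies for free variables. -/
def msubst : CE L V → (ℕ → CE L V) → CE L V
  | .fail, _ => .fail
  | .var X, ρ => ρ X
  | .list I S τ, ρ => .list I (fun i => (S i).msubst ρ) τ
  | .guard u S, ρ => .guard u (S.msubst ρ)
  | .choice S S', ρ => .choice (S.msubst ρ) (S'.msubst ρ)
  | .mu X S, ρ => .mu X (S.msubst (Function.update ρ X (.var X)))
  | .most S, ρ => .most (S.msubst ρ)
  | .cond S S', ρ => .cond (S.msubst ρ) (S'.msubst ρ)

theorem subst_of_not_freeIn {X : ℕ} {R S : CE L V} (h : ¬ S.FreeIn X) : S.subst X R = S := by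
  induction S with
  | fail => rfl
  | var Y => exact if_neg h
  | list I S τ ih => exact congrArg (CE.list I · τ) (funext fun i => ih i fun hi => h ⟨i, hi⟩)
  | guard u S ih => exact congrArg _ (ih h)
  | choice S S' ih ih' =>
    exact congrArg₂ _ (ih fun hX => h (.inl hX)) (ih' fun hX => h (.inr hX))
  | mu Y S ih =>
    by_cases hY : Y = X
    · exact if_pos hY
    · exact (if_neg hY).trans (congrArg _ (ih fun hX => h ⟨hY, hX⟩))
  | most S ih => exact congrArg _ (ih h)
  | cond S S' ih ih' =>
    exact congrArg₂ _ (ih fun hX => h (.inl hX)) (ih' fun hX => h (.inr hX))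

/-- The environment leaves `X` in place and introduces no further free `X`, so a later substitution
for `X` fills exactly that slot. This identifies the unfolding of an instance of `μX.S` with an
instance of its body. -/
theorem subst_msubst {X : ℕ} {R : CE L V} (S : CE L V) : ∀ ρ : ℕ → CE L V,
    (∀ Z, Z ≠ X → ¬ (ρ Z).FreeIn X) → ρ X = .var X →
    (S.msubst ρ).subst X R = S.msubst (Function.update ρ X R) := by
  induction S with
  | fail => intros; rfl
  | var Y =>
    intro ρ h hX
    by_cases hY : Y = X
    · subst hY; simp [msubst, hX, subst]
    · simp [msubst, hY, subst_of_not_freeIn (h Y hY)]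
  | list I S τ ih =>
    intro ρ h hX
    exact congrArg (CE.list I · τ) (funext fun i => ih i ρ h hX)
  | guard u S ih => exact fun ρ h hX => congrArg _ (ih ρ h hX)
  | choice S S' ih ih' => exact fun ρ h hX => congrArg₂ _ (ih ρ h hX) (ih' ρ h hX)
  | mu Y S ih =>
    intro ρ h hX
    by_cases hY : Y = X
    · subst hY; simp [msubst, subst]
    · simp only [msubst, subst, hY, if_false]
      rw [ih, Function.update_comm hY]
      · intro Z hZ
        by_cases hZY : Z = Y
        · subst hZY; simpa [FreeIn] using hZ
        · simpa [hZY] using h Z hZ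
      · simpa [Ne.symm hY] using hX
  | most S ih => exact fun ρ h hX => congrArg _ (ih ρ h hX)
  | cond S S' ih ih' => exact fun ρ h hX => congrArg₂ _ (ih ρ h hX) (ih' ρ h hX)

theorem msubst_eq_self (S : CE L V) : ∀ ρ : ℕ → CE L V,
    (∀ X, S.FreeIn X → ρ X = .var X) → S.msubst ρ = S := by
  induction S with
  | fail => intros; rfl
  | var Y => exact fun ρ h => h Y rfl
  | list I S τ ih =>
    exact fun ρ h => congrArg (CE.list I · τ) (funext fun i => ih i ρ fun X hX => h X ⟨i, hX⟩)
  | guard u S ih => exact fun ρ h => congrArg _ (ih ρ h)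
  | choice S S' ih ih' =>
    exact fun ρ h => congrArg₂ _ (ih ρ fun X hX => h X (.inl hX)) (ih' ρ fun X hX => h X (.inr hX))
  | mu Y S ih =>
    refine fun ρ h => congrArg _ (ih _ fun X hX => ?_)
    by_cases hXY : X = Y
    · subst hXY; simp
    · simpa [hXY] using h X ⟨Ne.symm hXY, hX⟩
  | most S ih => exact fun ρ h => congrArg _ (ih ρ h)
  | cond S S' ih ih' =>
    exact fun ρ h => congrArg₂ _ (ih ρ fun X hX => h X (.inl hX)) (ih' ρ fun X hX => h X (.inr hX))

theorem freeIn_msubst {Y : ℕ} (S : CE L V) : ∀ ρ : ℕ → CE L V,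
    (S.msubst ρ).FreeIn Y → ∃ Z, (ρ Z).FreeIn Y := by
  induction S with
  | fail => exact fun ρ h => h.elim
  | var X => exact fun ρ h => ⟨X, h⟩
  | list I S τ ih => exact fun ρ ⟨i, hi⟩ => ih i ρ hi
  | guard u S ih => exact ih
  | choice S S' ih ih' => exact fun ρ h => h.elim (ih ρ) (ih' ρ)
  | mu X S ih =>
    rintro ρ ⟨hX, h⟩
    obtain ⟨Z, hZ⟩ := ih _ h
    by_cases hZX : Z = X
    · subst hZX
      rw [Function.update_self] at hZ
      exact (hX hZ).elim
    · rw [Function.update_of_ne hZX] at hZ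
      exact ⟨Z, hZ⟩
  | most S ih => exact ih
  | cond S S' ih ih' => exact fun ρ h => h.elim (ih ρ) (ih' ρ)

theorem msubst_closed {S : CE L V} {ρ : ℕ → CE L V} (hρ : ∀ Z, (ρ Z).Closed) :
    (S.msubst ρ).Closed := fun _ hY => (freeIn_msubst S ρ hY).elim fun Z hZ => hρ Z _ hZ

/-- The instances, with closed strategies for the variables, of the subexpressions of a strategy.
-/
noncomputable def closure : CE L V → (ℕ → CE L V) → Set (CE L V)
  | .fail, _ => {.fail}
  | .var X, ρ => {ρ X}
  | .list I S τ, ρ => insert ((CE.list I S τ).msubst ρ) (⋃ i, (S i).closure ρ)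
  | .guard u S, ρ => insert ((CE.guard u S).msubst ρ) (S.closure ρ)
  | .choice S S', ρ => insert ((CE.choice S S').msubst ρ) (S.closure ρ ∪ S'.closure ρ)
  | .mu X S, ρ =>
      insert ((CE.mu X S).msubst ρ) (S.closure (Function.update ρ X ((CE.mu X S).msubst ρ)))
  | .most S, ρ =>
      insert ((CE.most S).msubst ρ)
        (insert (.list (Finset.Icc 1 (maxArity L)) (fun _ => S.msubst ρ) none) (S.closure ρ))
  | .cond S S', ρ => insert ((CE.cond S S').msubst ρ) (S'.closure ρ)

theorem closure_finite (S : CE L V) : ∀ ρ : ℕ → CE L V, (S.closure ρ).Finite := by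
  induction S with
  | fail => exact fun _ => Set.finite_singleton _
  | var X => exact fun _ => Set.finite_singleton _
  | list I S τ ih => exact fun ρ => (Set.finite_iUnion fun i => ih i ρ).insert _
  | guard u S ih => exact fun ρ => (ih ρ).insert _
  | choice S S' ih ih' => exact fun ρ => ((ih ρ).union (ih' ρ)).insert _
  | mu X S ih => exact fun ρ => (ih _).insert _
  | most S ih => exact fun ρ => ((ih ρ).insert _).insert _
  | cond S S' ih ih' => exact fun ρ => (ih' ρ).insert _

theorem msubst_mem_closure (S : CE L V) (ρ : ℕ → CE L V) : S.msubst ρ ∈ S.closure ρ := by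
  cases S <;> simp [closure, msubst]

/-- Passing to a component stays among instances of subexpressions, until a variable is reached; its
value in the environment may have successors outside the closure, hence the second alternative. When
that variable is bound by an enclosing `μX`, its value is that fixed point, and its unfolding is
again an instance of the body. -/
theorem succ_mem_closure {U U' : CE L V} (hU : Succ U U') (S : CE L V) : ∀ ρ : ℕ → CE L V,
    (∀ Z, (ρ Z).Closed) → U ∈ S.closure ρ → U' ∈ S.closure ρ ∨ ∃ X, Succ (ρ X) U' := by
  induction S with
  | fail =>
    rintro ρ hρ rfl
    cases hU
  | var X =>
    rintro ρ hρ rfl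
    exact .inr ⟨X, hU⟩
  | list I S τ ih =>
    rintro ρ hρ (rfl | h)
    · cases hU with
      | list _ _ _ i =>
        exact .inl (.inr (Set.mem_iUnion.2 ⟨i, msubst_mem_closure _ _⟩))
    · obtain ⟨i, hi⟩ := Set.mem_iUnion.1 h
      exact (ih i ρ hρ hi).imp_left fun h => .inr (Set.mem_iUnion.2 ⟨i, h⟩)
  | guard u S ih =>
    rintro ρ hρ (rfl | h)
    · cases hU
      exact .inl (.inr (msubst_mem_closure _ _))
    · exact (ih ρ hρ h).imp_left .inr
  | choice S S' ih ih' =>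
    rintro ρ hρ (rfl | h | h)
    · cases hU
      · exact .inl (.inr (.inl (msubst_mem_closure _ _)))
      · exact .inl (.inr (.inr (msubst_mem_closure _ _)))
    · exact (ih ρ hρ h).imp_left fun h => .inr (.inl h)
    · exact (ih' ρ hρ h).imp_left fun h => .inr (.inr h)
  | mu X S ih =>
    intro ρ hρ h
    have key : ∀ {U'}, Succ ((CE.mu X S).msubst ρ) U' →
        U' ∈ S.closure (Function.update ρ X ((CE.mu X S).msubst ρ)) := by
      intro U' h
      have hc : ∀ Z, Z ≠ X → ¬ (Function.update ρ X (.var X) Z).FreeIn X := by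
        intro Z hZ
        rw [Function.update_of_ne hZ]
        exact hρ Z X
      generalize hm : (CE.mu X S).msubst ρ = m at h
      cases h <;> cases hm
      change (S.msubst (Function.update ρ X (.var X))).subst X ((CE.mu X S).msubst ρ) ∈ _
      rw [subst_msubst S _ hc (Function.update_self ..), Function.update_idem]
      exact msubst_mem_closure _ _
    rcases h with rfl | h
    · exact .inl (.inr (key hU))
    · have hc : ∀ Z, (Function.update ρ X ((CE.mu X S).msubst ρ) Z).Closed := by
        intro Z
        by_cases hZX : Z = X
        · subst hZX
          rw [Function.update_self]
          exact msubst_closed hρ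
        · rw [Function.update_of_ne hZX]
          exact hρ Z
      rcases ih _ hc h with h | ⟨Y, hY⟩
      · exact .inl (.inr h)
      -- A successor obtained through `X` itself is the unfolding of the fixed point, which `key`
      -- places in the closure; any other variable belongs to the outer environment.
      · by_cases hYX : Y = X
        · subst hYX
          rw [Function.update_self] at hY
          exact .inl (.inr (key hY))
        · rw [Function.update_of_ne hYX] at hY
          exact .inr ⟨Y, hY⟩
  | most S ih =>
    rintro ρ hρ (rfl | rfl | h)
    · cases hU
      · exact .inl (.inr (.inr (msubst_mem_closure _ _)))
      · exact .inl (.inr (.inl rfl))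
    · cases hU
      exact .inl (.inr (.inr (msubst_mem_closure _ _)))
    · exact (ih ρ hρ h).imp_left fun h => .inr (.inr h)
  | cond S S' ih ih' =>
    rintro ρ hρ (rfl | h)
    · cases hU
      exact .inl (.inr (msubst_mem_closure _ _))
    · exact (ih' ρ hρ h).imp_left .inr

/-- A closed strategy generates finitely many strategies. -/
theorem exists_finite_succ_closed {S : CE L V} (hS : S.Closed) :
    ∃ C : Set (CE L V), C.Finite ∧ S ∈ C ∧ ∀ U ∈ C, ∀ U', Succ U U' → U' ∈ C := by
  -- The failing strategy serves as a dummy value: it is closed, has no successor, and is never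
  -- substituted into the closed strategy `S`.
  refine ⟨S.closure fun _ => .fail, closure_finite S _, ?_, fun U hU U' h => ?_⟩
  · have := msubst_mem_closure S fun _ => .fail
    rwa [msubst_eq_self S _ fun X hX => (hS X hX).elim] at this
  · rcases succ_mem_closure h S (fun _ => .fail) (fun _ _ h => h) hU with h | ⟨X, ⟨⟩⟩
    exact h

/-- The size of a strategy, as far as it matters to the unification of tuples: fixed points count
as atoms, and a `Most` as more than the jumps that it is replaced by. -/
def size : CE L V → ℕ
  | .fail => 0
  | .var _ => 0
  | .list _ S _ => (Finset.univ.sup fun i => (S i).size) + 1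
  | .guard _ S => S.size + 1
  | .choice S S' => S.size + S'.size + 1
  | .mu _ _ => 0
  | .most S => S.size + 2
  | .cond _ S => S.size + 1

theorem size_lt_list (I : Finset ℕ) (S : {i // i ∈ I} → CE L V) (τ : Option (Ctx L V))
    (i : {i // i ∈ I}) : (S i).size < (CE.list I S τ).size :=
  Nat.lt_succ_of_le (Finset.le_sup (f := fun i => (S i).size) (Finset.mem_univ i))

theorem size_list_const (I : Finset ℕ) (S : CE L V) (τ : Option (Ctx L V)) :
    (CE.list I (fun _ => S) τ).size < (CE.most S).size :=
  Nat.succ_lt_succ (Nat.lt_succ_of_le (Finset.sup_le fun _ _ => le_rfl))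

end CE

/-! ### Normalization -/

/-- `P` can be reduced to a strategy. -/
def Normalizes (P : PreCE L V) : Prop := ∃ T : CE L V, Relation.ReflTransGen Step P T.toPre

namespace Normalizes

theorem toPre (S : CE L V) : Normalizes S.toPre := ⟨S, .refl⟩

theorem guard (u : L.Term V) {P : PreCE L V} : Normalizes P → Normalizes (.guard u P) :=
  fun ⟨T, h⟩ => ⟨.guard u T, h.lift (PreCE.guard u) fun _ _ => .guard⟩

theorem choice {P P' : PreCE L V} : Normalizes P → Normalizes P' → Normalizes (.choice P P') :=
  fun ⟨T, h⟩ ⟨T', h'⟩ => ⟨.choice T T',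
    (h.lift (PreCE.choice · P') fun _ _ => .choice_left).trans
      (h'.lift (PreCE.choice T.toPre) fun _ _ => .choice_right)⟩

theorem mu (X : ℕ) {P : PreCE L V} : Normalizes P → Normalizes (.mu X P) :=
  fun ⟨T, h⟩ => ⟨.mu X T, h.lift (PreCE.mu X) fun _ _ => .mu⟩

theorem most {P : PreCE L V} : Normalizes P → Normalizes (.most P) :=
  fun ⟨T, h⟩ => ⟨.most T, h.lift PreCE.most fun _ _ => .most⟩

theorem cond (S : CE L V) {P : PreCE L V} : Normalizes P → Normalizes (.cond S P) :=
  fun ⟨T, h⟩ => ⟨.cond S T, h.lift (PreCE.cond S) fun _ _ => .cond⟩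

theorem _root_.CES.reduces_list {I : Finset ℕ} {P : {i // i ∈ I} → PreCE L V}
    {τ : Option (Ctx L V)} (i : {i // i ∈ I}) {Q : PreCE L V}
    (h : Relation.ReflTransGen Step (P i) Q) :
    Relation.ReflTransGen Step (.list I P τ) (.list I (Function.update P i Q) τ) := by
  induction h with
  | refl => rw [Function.update_eq_self]
  | @tail Q Q' _ h ih =>
    refine ih.tail ?_
    have := Step.list (P := Function.update P i Q) (τ := τ) i (Q := Q')
      (by rwa [Function.update_self])
    rwa [Function.update_idem] at this

theorem list {I : Finset ℕ} {P : {i // i ∈ I} → PreCE L V} (τ : Option (Ctx L V))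
    (h : ∀ i, Normalizes (P i)) : Normalizes (.list I P τ) := by
  choose T hT using h
  -- A step changes one component only, so the components are normalized one after another; `s`
  -- collects those already done.
  have key : ∀ s : Finset {i // i ∈ I}, Relation.ReflTransGen Step (.list I P τ)
      (.list I (s.piecewise (fun i => (T i).toPre) P) τ) := by
    intro s
    induction s using Finset.induction_on with
    | empty => rw [Finset.piecewise_empty]
    | insert j s hj ih =>
      rw [Finset.piecewise_insert]
      refine ih.trans (reduces_list j ?_)
      rw [Finset.piecewise_eq_of_notMem _ _ _ hj]
      exact hT j
  have := key Finset.univ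
  rw [Finset.piecewise_univ] at this
  exact ⟨.list I T τ, this⟩

end Normalizes

/-- The pairs of strategies from `C` that are not yet in the memory. -/
def remaining (C : Set (CE L V)) (M : Memory L V) : Set (CE L V × CE L V) :=
  {p ∈ C ×ˢ C | ∀ Y, (p.1, p.2, Y) ∉ M}

theorem remaining_insert_lt {C : Set (CE L V)} (hC : C.Finite) {M : Memory L V} {S S' : CE L V}
    {Z : ℕ} (hS : S ∈ C) (hS' : S' ∈ C) (hM : ∀ Y, (S, S', Y) ∉ M) :
    (remaining C (M ∪ {(S, S', Z)})).ncard < (remaining C M).ncard := by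
  refine Set.ncard_lt_ncard ?_ ((hC.prod hC).subset fun p hp => hp.1)
  refine ⟨fun p hp => ⟨hp.1, fun Y hY => hp.2 Y (.inl hY)⟩, fun h => ?_⟩
  exact (h (show (S, S') ∈ remaining C M from ⟨⟨hS, hS'⟩, hM⟩)).2 Z (.inr rfl)

/-- An unfolding may increase the size but records a pair of `C` absent from the memory. Every other
rule keeps the memory in its tuples and shrinks their total size, including the expansion of `Most`
into jumps. -/
theorem Rule.normalizes {C : Set (CE L V)} (hC : C.Finite)
    (hsucc : ∀ U ∈ C, ∀ U', Succ U U' → U' ∈ C) {k : ℕ} {S S' : CE L V} {M : Memory L V}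
    {P : PreCE L V} (h : Rule k S S' M P) (hS : S ∈ C) (hS' : S' ∈ C) (hM : M.Finite)
    (ih : ∀ U ∈ C, ∀ U' ∈ C, ∀ N : Memory L V, N.Finite →
      ((remaining C N).ncard < (remaining C M).ncard ∨
        N = M ∧ U.size + U'.size < S.size + S'.size) → Normalizes (.tuple U U' N)) :
    Normalizes P := by
  have ih' : ∀ U ∈ C, ∀ U' ∈ C, U.size + U'.size < S.size + S'.size →
      Normalizes (.tuple U U' M) := fun U hU U' hU' h => ih U hU U' hU' M hM (.inr ⟨rfl, h⟩)
  cases h with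
  | fail_left => exact .toPre .fail
  | fail_right => exact .toPre .fail
  | ins_ins => exact .toPre _
  | guard_left => exact .guard _ (ih' _ (hsucc _ hS _ (.guard _ _)) _ hS' (by simp [size]))
  | guard_right => exact .guard _ (ih' _ hS _ (hsucc _ hS' _ (.guard _ _)) (by simp [size]))
  | jump_jump i S S' =>
    refine .list _ fun j => ih' _ (hsucc _ hS _ (.list _ _ _ ⟨i, Finset.mem_singleton_self i⟩))
      _ (hsucc _ hS' _ (.list _ _ _ ⟨i, Finset.mem_singleton_self i⟩)) ?_
    exact Nat.add_lt_add (size_lt_list {i} (fun _ => S) none ⟨i, Finset.mem_singleton_self i⟩)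
      (size_lt_list {i} (fun _ => S') none ⟨i, Finset.mem_singleton_self i⟩)
  | list_list I J S S' τ τ' =>
    refine .cond _ (.cond _ (.list _ fun i => ?_))
    split_ifs with hI hJ
    · exact .choice (ih' _ (hsucc _ hS _ (.list _ _ _ _)) _ (hsucc _ hS' _ (.list _ _ _ _))
        (Nat.add_lt_add (size_lt_list _ _ _ _) (size_lt_list _ _ _ _)))
        (.choice (.toPre _) (.toPre _))
    · exact .toPre _
    · exact .toPre _
  | choice_left =>
    exact .choice (ih' _ (hsucc _ hS _ (.choice_left _ _)) _ hS' (by simp only [size]; omega))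
      (ih' _ (hsucc _ hS _ (.choice_right _ _)) _ hS' (by simp only [size]; omega))
  | choice_right =>
    exact .choice (ih' _ hS _ (hsucc _ hS' _ (.choice_left _ _)) (by simp only [size]; omega))
      (ih' _ hS _ (hsucc _ hS' _ (.choice_right _ _)) (by simp only [size]; omega))
  | cond_left => exact .cond _ (ih' _ (hsucc _ hS _ (.cond _ _)) _ hS' (by simp [size]))
  | cond_right => exact .cond _ (ih' _ hS _ (hsucc _ hS' _ (.cond _ _)) (by simp [size]))
  | most_most =>
    refine .cond _ (.cond _ (.most (.choice ?_ (.choice (.toPre _) (.toPre _)))))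
    exact ih' _ (hsucc _ hS _ (.most _)) _ (hsucc _ hS' _ (.most _)) (by simp only [size]; omega)
  | most_list =>
    exact ih' _ (hsucc _ hS _ (.most_list _)) _ hS' (Nat.add_lt_add_right (size_list_const _ _ _) _)
  | list_most =>
    exact ih' _ hS _ (hsucc _ hS' _ (.most_list _)) (Nat.add_lt_add_left (size_list_const _ _ _) _)
  | mu_left_unfold X S S' M Z hZM =>
    exact .mu _ (ih _ (hsucc _ hS _ (.mu _ _)) _ hS' _ (hM.union (Set.finite_singleton _))
      (.inl (remaining_insert_lt hC hS hS' hZM)))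
  | mu_left_memory => exact .toPre (.var _)
  | mu_right_unfold X S S' M Z hZM =>
    exact .mu _ (ih _ hS _ (hsucc _ hS' _ (.mu _ _)) _ (hM.union (Set.finite_singleton _))
      (.inl (remaining_insert_lt hC hS hS' hZM)))
  | mu_right_memory => exact .toPre (.var _)

/-- Lexicographic induction: the outer one on the number of unrecorded pairs, the inner one on the
total size with the memory fixed. Only the rule of highest priority is followed, and one fresh
variable is chosen at each unfolding. -/
theorem normalizes_tuple {C : Set (CE L V)} (hC : C.Finite) (hcl : ∀ U ∈ C, U.Closed)
    (hsucc : ∀ U ∈ C, ∀ U', Succ U U' → U' ∈ C) {S S' : CE L V} {M : Memory L V} (hS : S ∈ C)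
    (hS' : S' ∈ C) (hM : M.Finite) : Normalizes (.tuple S S' M) := by
  induction hn : (remaining C M).ncard using Nat.strong_induction_on generalizing S S' M with
  | _ n ihn =>
    induction hm : S.size + S'.size using Nat.strong_induction_on generalizing S S' with
    | _ m ihm =>
      obtain ⟨k, P, hP, hstep⟩ := exists_rule_step (hcl S hS) (hcl S' hS') hM
      obtain ⟨T, hT⟩ := hP.normalizes hC hsucc hS hS' hM fun U hU U' hU' N hN h => by
        rcases h with h | ⟨rfl, h⟩
        · exact ihn _ (hn ▸ h) hU hU' hN rfl
        · exact ihm _ (hm ▸ h) hU hU' rfl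
      exact ⟨T, hT.head hstep⟩

theorem exists_isNormalForm {S R : CE L V} (hS : S.Closed) (hR : R.Closed) :
    ∃ N, IsNormalForm (.tuple S R ∅) N := by
  obtain ⟨C, hC, hSC, hCsucc⟩ := exists_finite_succ_closed hS
  obtain ⟨D, hD, hRD, hDsucc⟩ := exists_finite_succ_closed hR
  have key : Normalizes (.tuple S R ∅) := by
    -- Both components of a tuple must range over one set, hence the union; restricting to closed
    -- strategies is harmless since successors preserve closedness.
    refine normalizes_tuple (C := {U ∈ C ∪ D | U.Closed}) ((hC.union hD).subset fun U h => h.1)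
      (fun U h => h.2) (fun U h U' hU => ⟨?_, hU.closed h.2⟩) ⟨.inl hSC, hS⟩ ⟨.inr hRD, hR⟩
      Set.finite_empty
    exact h.1.imp (fun h => hCsucc U h U' hU) fun h => hDsucc U h U' hU
  obtain ⟨T, hT⟩ := key
  exact ⟨T.toPre, hT, not_step_toPre T⟩

theorem exists_eq_toPre_of_isNormalForm {S R : CE L V} (hS : S.Closed) (hR : R.Closed)
    {N : PreCE L V} (hN : IsNormalForm (.tuple S R ∅) N) :
    ∃ T : CE L V, N = T.toPre ∧ Unifies S R ∅ T := by
  have hv : N.Valid := by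
    have hP : (PreCE.tuple S R (∅ : Memory L V)).Valid := ⟨hS, hR, Set.finite_empty⟩
    exact Relation.ReflTransGen.rec (motive := fun Q _ => Q.Valid) hP (fun _ h ih => h.valid ih) hN.1
  obtain ⟨T, rfl⟩ := exists_eq_toPre hv hN.2
  exact ⟨T, rfl, realizes_of_reduces hN.1 (PreCE.realizes_toPre.2 rfl)⟩

end CES

theorem mainTheorem1 {L : FirstOrder.Language} {V : Type*}
    (hL : BddAbove {n | Nonempty (L.Functions n)})
    (S R : CES.CE L V) (hS : S.Closed) (hS' : S.Monotonic) (hR : R.Closed) (hR' : R.Monotonic) :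
    (∃ N, CES.IsNormalForm (.tuple S R ∅) N) ∧
    ∀ N, CES.IsNormalForm (.tuple S R ∅) N →
      ∃ T : CES.CE L V, N = T.toPre ∧ T.Closed ∧
        ∀ t : L.Term V, CES.CE.psi t T ≈ (CES.CE.psi t S).unify (CES.CE.psi t R) := by
  refine ⟨CES.exists_isNormalForm hS hR, fun N hN => ?_⟩
  obtain ⟨T, rfl, hT⟩ := CES.exists_eq_toPre_of_isNormalForm hS hR hN
  refine ⟨T, rfl, fun Y hY => ?_, fun t => ?_⟩
  · obtain ⟨A, B, hAB⟩ := hT.freeIn hS hR Y hY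
    exact hAB
  -- The empty memory is sound for any environment, in particular for the constantly failing one
  -- used by `psi`.
  · exact hT.sound hL hS hS' hR hR' _ t fun A B Y hAB => hAB.elim
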